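/- Let $N\ge 1$ be an integer and let $\theta=(\theta_{ij})_{i,j=0}^N\in M_{N+1}(\mathbb R)$ be antisymmetric, $\theta_{ij}=-\theta_{ji}$. Let $\mathcal T^{N+1}_\theta$ be the universal unital $C^*$-algebra generated by isometries $w_0,\dots,w_N$ with $w_jw_k=e^{2\pi i\theta_{jk}}w_kw_j$ and $w_j^*w_k=e^{-2\pi i\theta_{jk}}w_kw_j^*$ for all $j\ne k$. Let $I_i$ be the closed two-sided ideal of $\mathcal T^{N+1}_\theta$ generated by $1-w_iw_i^*$, and for $i\neq j$ put $B_i:=\mathcal T^{N+1}_\theta/I_i$ and $B_{ij}:=B_{ji}:=\mathcal T^{N+1}_\theta/(I_i+I_j)$, with quotient maps $\sigma_i:\mathcal T^{N+1}_\theta\to B_i$ and $\pi^i_j:B_i\to B_{ij}$. Let $$C(S^{2N+1}_{H,\theta}):=\Big\{(b_0,\dots,b_N)\in\bigoplus_{i=0}^N B_i \;\Big|\; \pi^i_j(b_i)=\pi^j_i(b_j)\text{ for all } i\ne j\Big\},$$ $\mathbf s_i:=(\sigma_0(w_i),\dots,\sigma_N(w_i))\in C(S^{2N+1}_{H,\theta})$,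 and let $U(1)$ act on $C(S^{2N+1}_{H,\theta})$ by $\alpha_\lambda(b_0,\dots,b_N)=(\lambda\cdot b_0,\dots,\lambda\cdot b_N)$, where $\lambda\cdot{}$ on $B_i$ is induced by the automorphism $w_j\mapsto\lambda w_j$ of $\mathcal T^{N+1}_\theta$. Let $A_\theta(N+1)$ be the universal unital $C^*$-algebra generated by isometries $s_0,\dots,s_N$ satisfying $$s_is_j=e^{2\pi i\theta_{ij}}s_js_i,\qquad s_is_j^*=e^{-2\pi i\theta_{ij}}s_j^*s_i\qquad(i\neq j),\qquad\text{and}\qquad \prod_{i=0}^N(1-s_is_i^*)=0.$$ Then there is a (point-norm continuous) $U(1)$-action on $A_\theta(N+1)$ by $*$-automorphisms such that $\lambda\cdot s_i=\lambda s_i$ for all $i$ and all $\lambda\in U(1)$, and there is a $U(1)$-equivariant $*$-isomorphism $\phi_\theta:A_\theta(N+1)\to C(S^{2N+1}_{H,\theta})$ such that $\phi_\theta(s_i)=\mathbf s_i$ for all $i$. Furthermore, the maps $\pi^i_j$ satisfy the cocycle condition: they are surjective, and for all distinct $i,j,k$, 1. $\pi^i_j(\ker\pi^i_k)=\pi^j_i(\ker\pi^j_k)$;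 2. if $\pi^{ij}_k:B_i/(\ker\pi^i_j+\ker\pi^i_k)\to B_{ij}/\pi^i_j(\ker\pi^i_k)$ denotes the isomorphism $[b]\mapsto\pi^i_j(b)+\pi^i_j(\ker\pi^i_k)$, then the isomorphisms $\phi^{ij}_k:=(\pi^{ij}_k)^{-1}\circ\pi^{ji}_k: B_j/(\ker\pi^j_i+\ker\pi^j_k)\to B_i/(\ker\pi^i_j+\ker\pi^i_k)$ satisfy $\phi^{ik}_j=\phi^{ij}_k\circ\phi^{jk}_i$. -/

import Mathlib

open scoped ComplexConjugate
noncomputable section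

/-- `*`-homomorphisms between `C*`-algebras are continuous. -/
theorem continuous_starAlgHom {A B : Type*} [CStarAlgebra A] [CStarAlgebra B]
    (f : A →⋆ₐ[ℂ] B) : Continuous f :=
  AddMonoidHomClass.continuous_of_bound f 1 fun a => by
    rw [one_mul]
    exact NonUnitalStarAlgHom.norm_apply_le f a

/-- The free unital complex `*`-algebra on `X`: noncommutative polynomials in letters
`(x, false)`, standing for `x`, and `(x, true)`, standing for `x*`. -/
def FreeStarAlgebra (X : Type*) : Type _ := FreeAlgebra ℂ (X × Bool)

namespace FreeStarAlgebra

variable {X : Type*}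

instance : Ring (FreeStarAlgebra X) := inferInstanceAs (Ring (FreeAlgebra ℂ (X × Bool)))
instance : Algebra ℂ (FreeStarAlgebra X) :=
  inferInstanceAs (Algebra ℂ (FreeAlgebra ℂ (X × Bool)))

/-- The letters of the free `*`-algebra. -/
def letter (x : X × Bool) : FreeStarAlgebra X := FreeAlgebra.ι ℂ x

/-- The generators of the free `*`-algebra. -/
def gen (x : X) : FreeStarAlgebra X := letter (x, false)

theorem induction {P : FreeStarAlgebra X → Prop}
    (hc : ∀ c : ℂ, P (algebraMap ℂ (FreeStarAlgebra X) c)) (hl : ∀ x, P (letter x))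
    (hm : ∀ a b, P a → P b → P (a * b)) (ha : ∀ a b, P a → P b → P (a + b))
    (a : FreeStarAlgebra X) : P a :=
  FreeAlgebra.induction ℂ (X × Bool) hc hl hm ha a

/-- Reversal of words, exchange of `x` and `x*`, and conjugation of coefficients, as a ring
homomorphism to the opposite ring. -/
def starAux : FreeStarAlgebra X →+* (FreeStarAlgebra X)ᵐᵒᵖ :=
  letI : Algebra ℂ (FreeStarAlgebra X)ᵐᵒᵖ :=
    ((algebraMap ℂ (FreeStarAlgebra X)ᵐᵒᵖ).comp (starRingEnd ℂ)).toAlgebra'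
      fun c x => Algebra.commutes (conj c) x
  (FreeAlgebra.lift ℂ fun x : X × Bool => MulOpposite.op (letter (x.1, !x.2))).toRingHom

theorem starAux_algebraMap (c : ℂ) :
    starAux (algebraMap ℂ (FreeStarAlgebra X) c)
      = MulOpposite.op (algebraMap ℂ (FreeStarAlgebra X) (conj c)) := by
  let _ : Algebra ℂ (FreeStarAlgebra X)ᵐᵒᵖ :=
    ((algebraMap ℂ (FreeStarAlgebra X)ᵐᵒᵖ).comp (starRingEnd ℂ)).toAlgebra'
      fun c x => Algebra.commutes (conj c) x
  exact (FreeAlgebra.lift ℂ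
    fun x : X × Bool => MulOpposite.op (letter (x.1, !x.2))).commutes c

theorem starAux_letter (x : X × Bool) :
    starAux (letter x) = MulOpposite.op (letter (x.1, !x.2)) := by
  let _ : Algebra ℂ (FreeStarAlgebra X)ᵐᵒᵖ :=
    ((algebraMap ℂ (FreeStarAlgebra X)ᵐᵒᵖ).comp (starRingEnd ℂ)).toAlgebra'
      fun c x => Algebra.commutes (conj c) x
  exact FreeAlgebra.lift_ι_apply (R := ℂ)
    (fun x : X × Bool => MulOpposite.op (letter (x.1, !x.2))) x

instance : StarRing (FreeStarAlgebra X) where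
  star a := (starAux a).unop
  star_involutive a := by
    refine induction (P := fun a => (starAux (starAux a).unop).unop = a) ?_ ?_ ?_ ?_ a
    · intro c; simp [starAux_algebraMap]
    · intro x; simp [starAux_letter]
    · intro a b ha hb; simp [ha, hb]
    · intro a b ha hb; simp [ha, hb]
  star_mul a b := by simp
  star_add a b := by simp

theorem star_def (a : FreeStarAlgebra X) : star a = (starAux a).unop := rfl

theorem star_letter (x : X × Bool) : star (letter x) = letter (x.1, !x.2) := by
  simp [star_def, starAux_letter]

theorem star_algebraMap' (c : ℂ) : star (algebraMap ℂ (FreeStarAlgebra X) c)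
    = algebraMap ℂ (FreeStarAlgebra X) (conj c) := by
  simp [star_def, starAux_algebraMap]

instance : StarModule ℂ (FreeStarAlgebra X) where
  star_smul c a := by
    rw [Algebra.smul_def, star_mul, star_algebraMap', ← Algebra.commutes, Algebra.smul_def]
    rfl

variable {B : Type*} [Ring B] [StarRing B] [Algebra ℂ B] [StarModule ℂ B]

/-- Evaluation of `*`-polynomials at a family of elements of a `*`-algebra. -/
def eval (b : X → B) : FreeStarAlgebra X →⋆ₐ[ℂ] B :=
  let f : FreeStarAlgebra X →ₐ[ℂ] B :=
    FreeAlgebra.lift ℂ (X := X × Bool) fun x : X × Bool => if x.2 then star (b x.1) else b x.1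
  have hl : ∀ x, f (letter x) = if x.2 then star (b x.1) else b x.1 :=
    fun x => FreeAlgebra.lift_ι_apply _ x
  { toFun := f
    map_one' := map_one f
    map_mul' := map_mul f
    map_zero' := map_zero f
    map_add' := map_add f
    commutes' := f.commutes
    map_star' := fun a => by
      refine induction (P := fun a => f (star a) = star (f a)) ?_ ?_ ?_ ?_ a
      · intro c
        rw [star_algebraMap']
        refine (f.commutes _).trans ?_
        refine Eq.trans ?_ (congrArg star (f.commutes c)).symm
        exact algebraMap_star_comm c
      · rintro ⟨x, b⟩
        rw [star_letter, hl, hl]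
        cases b <;> simp
      · intro a b ha hb
        rw [star_mul]
        refine (map_mul f _ _).trans ?_
        rw [ha, hb, ← star_mul]
        exact congrArg star (map_mul f a b).symm
      · intro a b ha hb
        rw [star_add]
        refine (map_add f _ _).trans ?_
        rw [ha, hb, ← star_add]
        exact congrArg star (map_add f a b).symm }

@[simp]
theorem eval_gen (b : X → B) (x : X) : eval b (gen x) = b x := by
  refine (FreeAlgebra.lift_ι_apply (R := ℂ) _ _).trans ?_
  simp

@[simp]
theorem eval_star (b : X → B) (a : FreeStarAlgebra X) : eval b (star a) = star (eval b a) :=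
  map_star (eval b) a

theorem letter_true (x : X) : letter (x, true) = star (gen x) := by
  simp [gen, star_letter]

theorem hom_ext {f g : FreeStarAlgebra X →⋆ₐ[ℂ] B} (h : ∀ x, f (gen x) = g (gen x)) :
    f = g := by
  ext a
  refine induction (P := fun a => f a = g a) ?_ ?_ ?_ ?_ a
  · intro c; simp [AlgHomClass.commutes]
  · rintro ⟨x, b⟩
    cases b
    · exact h x
    · rw [letter_true, map_star, map_star, h]
  · intro a b ha hb; simp [ha, hb]
  · intro a b ha hb; simp [ha, hb]

end FreeStarAlgebra

/-- A `C*`-seminorm on a complex `*`-algebra. -/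
structure CStarSeminorm (F : Type*) [Ring F] [StarRing F] [Algebra ℂ F] extends
    Seminorm ℂ F where
  mul_le' : ∀ a b, toFun (a * b) ≤ toFun a * toFun b
  star_mul_self' : ∀ a, toFun (star a * a) = toFun a * toFun a

namespace UniversalCStar

variable {X : Type*}

open FreeStarAlgebra

/-- The relations `R`, together with the relations that say that the generators are
isometries. -/
def relations (R : Set (FreeStarAlgebra X)) : Set (FreeStarAlgebra X) :=
  (Set.range fun x : X => star (gen x) * gen x - 1) ∪ R

/-- The `C*`-seminorms on the free `*`-algebra which vanish on the relations. -/
def Admissible (R : Set (FreeStarAlgebra X)) : Type _ :=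
  {p : CStarSeminorm (FreeStarAlgebra X) // ∀ r ∈ relations R, p.toSeminorm r = 0}

variable {R : Set (FreeStarAlgebra X)}

instance : Nonempty (Admissible R) :=
  ⟨⟨{ (0 : Seminorm ℂ (FreeStarAlgebra X)) with
      mul_le' := fun a b => by
        change (0 : ℝ) ≤ 0 * 0
        simp
      star_mul_self' := fun a => by
        change (0 : ℝ) = 0 * 0
        simp }, fun r _ => rfl⟩⟩

theorem Admissible.mul_le (p : Admissible R) (a b : FreeStarAlgebra X) :
    p.1.toSeminorm (a * b) ≤ p.1.toSeminorm a * p.1.toSeminorm b := p.1.mul_le' a b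

theorem Admissible.star_mul_self (p : Admissible R) (a : FreeStarAlgebra X) :
    p.1.toSeminorm (star a * a) = p.1.toSeminorm a * p.1.toSeminorm a := p.1.star_mul_self' a

theorem Admissible.one_le (p : Admissible R) : p.1.toSeminorm 1 ≤ 1 := by
  have h := p.star_mul_self 1
  rw [star_one, mul_one] at h
  nlinarith [apply_nonneg p.1.toSeminorm 1]

theorem Admissible.le_star (p : Admissible R) (a : FreeStarAlgebra X) :
    p.1.toSeminorm a ≤ p.1.toSeminorm (star a) := by
  have h := p.star_mul_self a
  have h' := p.mul_le (star a) a
  rcases (apply_nonneg p.1.toSeminorm a).eq_or_lt with h0 | h0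
  · rw [← h0]; exact apply_nonneg _ _
  · exact le_of_mul_le_mul_right (h ▸ h') h0

theorem Admissible.star_eq (p : Admissible R) (a : FreeStarAlgebra X) :
    p.1.toSeminorm (star a) = p.1.toSeminorm a :=
  le_antisymm (by simpa using p.le_star (star a)) (p.le_star a)

theorem Admissible.gen_le (p : Admissible R) (x : X) : p.1.toSeminorm (gen x) ≤ 1 := by
  have h := p.star_mul_self (gen x)
  have h1 : p.1.toSeminorm (star (gen x) * gen x - 1) = 0 := p.2 _ (Or.inl ⟨x, rfl⟩)
  have h2 := map_add_le_add p.1.toSeminorm (star (gen x) * gen x - 1) 1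
  rw [sub_add_cancel, h1] at h2
  nlinarith [p.one_le, apply_nonneg p.1.toSeminorm (gen x)]

theorem bddAbove (R : Set (FreeStarAlgebra X)) (a : FreeStarAlgebra X) :
    BddAbove (Set.range fun p : Admissible R => p.1.toSeminorm a) := by
  suffices h : ∃ C : ℝ, ∀ p : Admissible R, p.1.toSeminorm a ≤ C by
    obtain ⟨C, hC⟩ := h
    exact ⟨C, by rintro _ ⟨p, rfl⟩; exact hC p⟩
  refine induction (P := fun a => ∃ C : ℝ, ∀ p : Admissible R, p.1.toSeminorm a ≤ C)
    ?_ ?_ ?_ ?_ a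
  · intro c
    refine ⟨‖c‖, fun p => ?_⟩
    rw [Algebra.algebraMap_eq_smul_one, map_smul_eq_mul]
    exact mul_le_of_le_one_right (norm_nonneg _) p.one_le
  · rintro ⟨x, b⟩
    refine ⟨1, fun p => ?_⟩
    cases b
    · exact p.gen_le x
    · rw [letter_true, p.star_eq]
      exact p.gen_le x
  · rintro a b ⟨C, hC⟩ ⟨D, hD⟩
    refine ⟨C * D, fun p => (p.mul_le a b).trans ?_⟩
    exact mul_le_mul (hC p) (hD p) (apply_nonneg _ _) ((apply_nonneg _ _).trans (hC p))
  · rintro a b ⟨C, hC⟩ ⟨D, hD⟩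
    exact ⟨C + D, fun p => (map_add_le_add _ a b).trans (add_le_add (hC p) (hD p))⟩

/-- The largest `C*`-seminorm on the free `*`-algebra which vanishes on the relations. -/
def univNorm (R : Set (FreeStarAlgebra X)) (a : FreeStarAlgebra X) : ℝ :=
  ⨆ p : Admissible R, p.1.toSeminorm a

theorem le_univNorm (p : Admissible R) (a : FreeStarAlgebra X) :
    p.1.toSeminorm a ≤ univNorm R a := le_ciSup (bddAbove R a) p

theorem univNorm_le {a : FreeStarAlgebra X} {C : ℝ}
    (h : ∀ p : Admissible R, p.1.toSeminorm a ≤ C) : univNorm R a ≤ C := ciSup_le h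

theorem univNorm_nonneg (a : FreeStarAlgebra X) : 0 ≤ univNorm R a :=
  (apply_nonneg _ _).trans (le_univNorm (Classical.arbitrary (Admissible R)) a)

theorem univNorm_mul_le (a b : FreeStarAlgebra X) :
    univNorm R (a * b) ≤ univNorm R a * univNorm R b :=
  univNorm_le fun p => (p.mul_le a b).trans
    (mul_le_mul (le_univNorm p a) (le_univNorm p b) (apply_nonneg _ _) (univNorm_nonneg a))

theorem univNorm_star (a : FreeStarAlgebra X) : univNorm R (star a) = univNorm R a := by
  simp only [univNorm, Admissible.star_eq]

theorem univNorm_mul_self_le (a : FreeStarAlgebra X) :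
    univNorm R a * univNorm R a ≤ univNorm R (star a * a) := by
  have h : univNorm R a ≤ Real.sqrt (univNorm R (star a * a)) := by
    refine univNorm_le fun p => Real.le_sqrt_of_sq_le ?_
    rw [sq, ← p.star_mul_self]
    exact le_univNorm p _
  calc univNorm R a * univNorm R a
      ≤ Real.sqrt (univNorm R (star a * a)) * Real.sqrt (univNorm R (star a * a)) :=
        mul_self_le_mul_self (univNorm_nonneg a) h
    _ = univNorm R (star a * a) := Real.mul_self_sqrt (univNorm_nonneg _)

/-- The free `*`-algebra, equipped with the universal `C*`-seminorm. -/
def Pre (_ : Set (FreeStarAlgebra X)) : Type _ := FreeStarAlgebra X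

instance : Ring (Pre R) := inferInstanceAs (Ring (FreeStarAlgebra X))
instance : Algebra ℂ (Pre R) := inferInstanceAs (Algebra ℂ (FreeStarAlgebra X))
instance : StarRing (Pre R) := inferInstanceAs (StarRing (FreeStarAlgebra X))
instance : StarModule ℂ (Pre R) := inferInstanceAs (StarModule ℂ (FreeStarAlgebra X))

instance : SeminormedAddCommGroup (Pre R) :=
  AddGroupSeminorm.toSeminormedAddCommGroup (E := Pre R)
    { toFun := univNorm R
      map_zero' := le_antisymm
        (univNorm_le fun p => (map_zero p.1.toSeminorm).le) (univNorm_nonneg _)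
      add_le' := fun a b => univNorm_le fun p => (map_add_le_add p.1.toSeminorm a b).trans
        (add_le_add (le_univNorm p a) (le_univNorm p b))
      neg' := fun a => by
        refine congrArg iSup (funext fun p => ?_)
        exact map_neg_eq_map p.1.toSeminorm a }

theorem norm_def (a : Pre R) : ‖a‖ = univNorm R a := rfl

instance : SeminormedRing (Pre R) where
  __ := (inferInstance : Ring (Pre R))
  __ := (inferInstance : SeminormedAddCommGroup (Pre R))
  norm_mul_le := univNorm_mul_le

instance : NormedAlgebra ℂ (Pre R) where
  norm_smul_le c a := univNorm_le fun p => by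
    refine (map_smul_eq_mul p.1.toSeminorm c a).trans_le ?_
    exact mul_le_mul_of_nonneg_left (le_univNorm p a) (norm_nonneg c)

end UniversalCStar

/-- The universal unital `C*`-algebra generated by isometries indexed by `X` and subject to the
relations `R`: the Hausdorff completion of the free `*`-algebra in the largest `C*`-seminorm
which vanishes on the relations. -/
def UniversalCStar {X : Type*} (R : Set (FreeStarAlgebra X)) : Type _ :=
  UniformSpace.Completion (UniversalCStar.Pre R)

namespace UniversalCStar

variable {X : Type*} {R : Set (FreeStarAlgebra X)}

open FreeStarAlgebra UniformSpace

instance : NormedRing (UniversalCStar R) :=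
  inferInstanceAs (NormedRing (Completion (Pre R)))

instance : NormedSpace ℂ (UniversalCStar R) :=
  inferInstanceAs (NormedSpace ℂ (Completion (Pre R)))

instance : Algebra ℂ (UniversalCStar R) :=
  inferInstanceAs (Algebra ℂ (Completion (Pre R)))

instance : CompleteSpace (UniversalCStar R) :=
  inferInstanceAs (CompleteSpace (Completion (Pre R)))

/-- The canonical map from the free `*`-algebra. -/
def ofFree (R : Set (FreeStarAlgebra X)) : FreeStarAlgebra X →+* UniversalCStar R :=
  (Completion.coeRingHom : Pre R →+* Completion (Pre R))

theorem norm_ofFree (a : FreeStarAlgebra X) : ‖ofFree R a‖ = univNorm R a :=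
  Completion.norm_coe (E := Pre R) a

theorem denseRange_ofFree : DenseRange (ofFree R) := Completion.denseRange_coe (α := Pre R)

theorem induction_on {P : UniversalCStar R → Prop} (a : UniversalCStar R)
    (hp : IsClosed {a | P a}) (h : ∀ a : FreeStarAlgebra X, P (ofFree R a)) : P a :=
  denseRange_ofFree.induction_on a hp h

theorem ofFree_algebraMap (c : ℂ) : ofFree R (algebraMap ℂ _ c) = algebraMap ℂ _ c := rfl

theorem ofFree_smul (c : ℂ) (a : FreeStarAlgebra X) : ofFree R (c • a) = c • ofFree R a := by
  rw [Algebra.smul_def, Algebra.smul_def, map_mul, ofFree_algebraMap]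

/-- The involution of the free `*`-algebra is isometric, hence extends. -/
def starFun : UniversalCStar R → UniversalCStar R :=
  Completion.map (fun a : Pre R => star a)

theorem isometry_star : Isometry (fun a : Pre R => star a) :=
  AddMonoidHomClass.isometry_of_norm (starAddEquiv : Pre R ≃+ Pre R) fun a => univNorm_star a

theorem continuous_starFun : Continuous (starFun (R := R)) := Completion.continuous_map

theorem starFun_ofFree (a : FreeStarAlgebra X) : starFun (ofFree R a) = ofFree R (star a) :=
  Completion.map_coe isometry_star.uniformContinuous _

instance : StarRing (UniversalCStar R) where
  star := starFun
  star_involutive a := by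
    refine induction_on (P := fun a => starFun (starFun a) = a) a
      (isClosed_eq (continuous_starFun.comp continuous_starFun) continuous_id) fun a => ?_
    rw [starFun_ofFree, starFun_ofFree, star_star]
  star_mul a b := by
    refine induction_on (P := fun a => starFun (a * b) = starFun b * starFun a) a
      (isClosed_eq (continuous_starFun.comp (continuous_mul_const b))
        (continuous_const.mul continuous_starFun)) fun a => ?_
    refine induction_on (P := fun b => starFun (ofFree R a * b) = starFun b * starFun (ofFree R a))
      b (isClosed_eq (continuous_starFun.comp (continuous_const_mul _))
        (continuous_starFun.mul continuous_const)) fun b => ?_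
    simp only [← map_mul, starFun_ofFree, star_mul]
  star_add a b := by
    refine induction_on (P := fun a => starFun (a + b) = starFun a + starFun b) a
      (isClosed_eq (continuous_starFun.comp (continuous_add_const b))
        (continuous_starFun.add continuous_const)) fun a => ?_
    refine induction_on (P := fun b => starFun (ofFree R a + b) = starFun (ofFree R a) + starFun b)
      b (isClosed_eq (continuous_starFun.comp (continuous_const_add _))
        (continuous_const.add continuous_starFun)) fun b => ?_
    simp only [← map_add, starFun_ofFree, star_add]

theorem star_ofFree (a : FreeStarAlgebra X) : star (ofFree R a) = ofFree R (star a) :=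
  starFun_ofFree a

theorem continuous_star' : Continuous (star : UniversalCStar R → UniversalCStar R) :=
  continuous_starFun

instance : CStarAlgebra (UniversalCStar R) where
  norm_smul_le c a := norm_smul_le c a
  norm_mul_self_le a := by
    refine induction_on (P := fun a => ‖a‖ * ‖a‖ ≤ ‖star a * a‖) a (isClosed_le
      (continuous_norm.mul continuous_norm)
      (continuous_norm.comp (continuous_star'.mul continuous_id))) fun a => ?_
    rw [star_ofFree, ← map_mul, norm_ofFree, norm_ofFree]
    exact univNorm_mul_self_le a
  star_smul c a := by
    refine induction_on (P := fun a => star (c • a) = star c • star a) a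
      (isClosed_eq (continuous_star'.comp (continuous_const_smul c))
        (continuous_star'.const_smul (star c))) fun a => ?_
    rw [← ofFree_smul, star_ofFree, star_ofFree, ← ofFree_smul, star_smul]

/-- The canonical generators of the universal `C*`-algebra. -/
def of (R : Set (FreeStarAlgebra X)) (x : X) : UniversalCStar R := ofFree R (gen x)

/-- The canonical map from the free `*`-algebra, as a `*`-homomorphism. -/
def ofFreeHom (R : Set (FreeStarAlgebra X)) : FreeStarAlgebra X →⋆ₐ[ℂ] UniversalCStar R :=
  { ofFree R with
    commutes' := ofFree_algebraMap
    map_star' := fun a => (star_ofFree a).symm }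

theorem ofFreeHom_eq : ofFreeHom R = eval (of R) := hom_ext fun x => by
  rw [eval_gen]; rfl

theorem ofFree_eq_zero {r : FreeStarAlgebra X} (hr : r ∈ relations R) : ofFree R r = 0 := by
  rw [← norm_eq_zero, norm_ofFree]
  exact le_antisymm (univNorm_le fun p => (p.2 r hr).le) (univNorm_nonneg _)

/-- The generators are isometries. -/
theorem star_of_mul_of (x : X) : star (of R x) * of R x = 1 := by
  have h := ofFree_eq_zero (R := R) (Or.inl ⟨x, rfl⟩)
  rw [map_sub, map_mul, map_one, ← star_ofFree, sub_eq_zero] at h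
  exact h

/-- The generators satisfy the relations. -/
theorem eval_of_eq_zero {r : FreeStarAlgebra X} (hr : r ∈ R) : eval (of R) r = 0 := by
  rw [← ofFreeHom_eq]
  exact ofFree_eq_zero (Or.inr hr)

section lift

variable {B : Type*} [CStarAlgebra B]

/-- Isometries that satisfy the relations induce an admissible `C*`-seminorm. -/
def admissibleOf (b : X → B) (hb : ∀ x, star (b x) * b x = 1)
    (hR : ∀ r ∈ R, eval b r = 0) : Admissible R :=
  ⟨{ toFun := fun a => ‖eval b a‖
     map_zero' := by simp
     add_le' := fun x y => by rw [map_add]; exact norm_add_le _ _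
     neg' := fun x => by rw [map_neg, norm_neg]
     smul' := fun c x => by rw [map_smul, norm_smul]
     mul_le' := fun x y => by rw [map_mul]; exact norm_mul_le _ _
     star_mul_self' := fun x => by
      rw [map_mul, map_star, CStarRing.norm_star_mul_self] }, by
    rintro r (⟨x, rfl⟩ | hr)
    · change ‖eval b (star (gen x) * gen x - 1)‖ = 0
      rw [map_sub, map_mul, map_star, eval_gen, map_one, hb, sub_self, norm_zero]
    · change ‖eval b r‖ = 0
      rw [hR r hr, norm_zero]⟩

theorem norm_eval_le (b : X → B) (hb : ∀ x, star (b x) * b x = 1)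
    (hR : ∀ r ∈ R, eval b r = 0) (a : FreeStarAlgebra X) : ‖eval b a‖ ≤ univNorm R a :=
  le_univNorm (admissibleOf b hb hR) a

/-- The evaluation at isometries that satisfy the relations, on the seminormed algebra. -/
def preLift (R : Set (FreeStarAlgebra X)) (b : X → B) : Pre R →+* B :=
  ((eval b : FreeStarAlgebra X →⋆ₐ[ℂ] B) : FreeStarAlgebra X →+* B)

theorem continuous_preLift (b : X → B) (hb : ∀ x, star (b x) * b x = 1)
    (hR : ∀ r ∈ R, eval b r = 0) : Continuous (preLift R b) :=
  AddMonoidHomClass.continuous_of_bound (preLift R b) 1 fun a => by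
    rw [one_mul]; exact norm_eval_le b hb hR a

/-- The homomorphism given by the universal property, as a ring homomorphism. -/
def liftRingHom (b : X → B) (hb : ∀ x, star (b x) * b x = 1)
    (hR : ∀ r ∈ R, eval b r = 0) : UniversalCStar R →+* B :=
  Completion.extensionHom (preLift R b) (continuous_preLift b hb hR)

theorem continuous_liftRingHom (b : X → B) (hb : ∀ x, star (b x) * b x = 1)
    (hR : ∀ r ∈ R, eval b r = 0) : Continuous (liftRingHom b hb hR) :=
  Completion.continuous_extension

theorem liftRingHom_ofFree (b : X → B) (hb : ∀ x, star (b x) * b x = 1)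
    (hR : ∀ r ∈ R, eval b r = 0) (a : FreeStarAlgebra X) :
    liftRingHom b hb hR (ofFree R a) = eval b a :=
  Completion.extensionHom_coe (preLift R b) (continuous_preLift b hb hR) _

/-- The universal property: isometries in a `C*`-algebra that satisfy the relations define a
`*`-homomorphism on the universal `C*`-algebra. -/
def lift (b : X → B) (hb : ∀ x, star (b x) * b x = 1)
    (hR : ∀ r ∈ R, eval b r = 0) : UniversalCStar R →⋆ₐ[ℂ] B :=
  { liftRingHom b hb hR with
    commutes' := fun c => by
      refine (liftRingHom_ofFree b hb hR (algebraMap ℂ _ c)).trans ?_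
      exact AlgHomClass.commutes (eval b) c
    map_star' := fun a => by
      refine induction_on (P := fun a => liftRingHom b hb hR (star a)
        = star (liftRingHom b hb hR a)) a (isClosed_eq
          ((continuous_liftRingHom b hb hR).comp continuous_star')
          (continuous_star.comp (continuous_liftRingHom b hb hR))) fun a => ?_
      rw [star_ofFree, liftRingHom_ofFree, liftRingHom_ofFree, map_star] }

@[simp]
theorem lift_of (b : X → B) (hb : ∀ x, star (b x) * b x = 1)
    (hR : ∀ r ∈ R, eval b r = 0) (x : X) : lift b hb hR (of R x) = b x :=
  (liftRingHom_ofFree b hb hR (gen x)).trans (eval_gen b x)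

/-- `*`-homomorphisms out of the universal `C*`-algebra are determined on generators. -/
theorem hom_ext {f g : UniversalCStar R →⋆ₐ[ℂ] B} (h : ∀ x, f (of R x) = g (of R x)) :
    f = g := by
  have hc : f.comp (ofFreeHom R) = g.comp (ofFreeHom R) := FreeStarAlgebra.hom_ext h
  ext a
  refine induction_on (P := fun a => f a = g a) a
    (isClosed_eq (continuous_starAlgHom f) (continuous_starAlgHom g)) fun a => ?_
  exact DFunLike.congr_fun hc a

end lift

end UniversalCStar

namespace CStarQuotient

variable {A : Type*} [CStarAlgebra A]

/-- Approximate right units in the ideals that contain a given element. -/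
theorem exists_approx (y : A) {ε : ℝ} (hε : 0 < ε) :
    ∃ g r : A, 1 - r = g * (star y * y) ∧ star r = r ∧ ‖r‖ ≤ 1 ∧ ‖y * r‖ ≤ ε := by
  obtain ⟨n, hn⟩ := exists_nat_gt (1 / ε ^ 2)
  have hn0 : (0 : ℝ) < n := lt_trans (by positivity) hn
  set h : A := star y * y with hh
  have hsa : IsSelfAdjoint h := IsSelfAdjoint.star_mul_self y
  have hsp : ∀ t ∈ spectrum ℝ h, 0 ≤ t := spectrum_star_mul_self_nonneg
  have hc : ContinuousOn (fun t : ℝ => (1 + n * t)⁻¹) (spectrum ℝ h) := by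
    refine ContinuousOn.inv₀ (by fun_prop) fun t ht => ?_
    have := hsp t ht
    positivity
  set r : A := cfc (fun t : ℝ => (1 + n * t)⁻¹) h with hr
  have hrsa : star r = r := cfc_predicate (R := ℝ) (p := IsSelfAdjoint) _ h
  have h1 : r * (h * r) = cfc (fun t : ℝ => (1 + n * t)⁻¹ * (t * (1 + n * t)⁻¹)) h := by
    rw [cfc_mul _ _ h hc (by fun_prop), cfc_mul _ _ h (by fun_prop) hc, cfc_id' ℝ h]
  have h2 : 1 - r = cfc (fun t : ℝ => ((n : ℝ) * (1 + n * t)⁻¹) * t) h := by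
    rw [← cfc_one ℝ h, hr]
    have : (1 : ℝ → ℝ) = fun _ => 1 := rfl
    rw [this, ← cfc_sub _ _ h (by fun_prop) hc]
    refine cfc_congr fun t ht => ?_
    have := hsp t ht
    have : (1 + n * t) ≠ 0 := by positivity
    field_simp
    ring
  refine ⟨cfc (fun t : ℝ => (n : ℝ) * (1 + n * t)⁻¹) h, r, ?_, hrsa, ?_, ?_⟩
  · rw [h2, cfc_mul _ _ h (by fun_prop) (by fun_prop), cfc_id' ℝ h]
  · refine norm_cfc_le zero_le_one fun t ht => ?_
    have := hsp t ht
    rw [Real.norm_of_nonneg (by positivity)]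
    exact inv_le_one_of_one_le₀ (by nlinarith)
  · refine abs_le_of_sq_le_sq' ?_ hε.le |>.2
    have h3 : ‖y * r‖ ^ 2 = ‖r * (h * r)‖ := by
      rw [sq, ← CStarRing.norm_star_mul_self, star_mul, hrsa, hh]
      simp only [mul_assoc]
    rw [h3, h1]
    refine norm_cfc_le (by positivity) fun t ht => ?_
    have ht0 := hsp t ht
    rw [Real.norm_of_nonneg (by positivity)]
    have h4 : 1 / (n : ℝ) ≤ ε ^ 2 := by
      rw [div_le_iff₀ hn0]
      rw [div_lt_iff₀ (by positivity)] at hn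
      linarith
    refine le_trans ?_ h4
    have h5 : (0 : ℝ) < 1 + n * t := by positivity
    have h6 : (1 + n * t)⁻¹ * (t * (1 + n * t)⁻¹) = t / (1 + n * t) ^ 2 := by
      field_simp
    rw [h6, div_le_div_iff₀ (by positivity) hn0]
    nlinarith [mul_nonneg hn0.le ht0, sq_nonneg (n * t)]

section Ideals

variable (I J : Ideal A)

theorem sub_mul_mem [I.IsTwoSided] {y g r : A} (hy : y ∈ I)
    (hr : 1 - r = g * (star y * y)) (a : A) : a * (1 - r) ∈ I := by
  rw [hr]
  exact I.mul_mem_left _ (I.mul_mem_left _ (I.mul_mem_left _ hy))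

/-- Closed two-sided ideals of `C*`-algebras are self-adjoint. -/
theorem star_mem [I.IsTwoSided] [hI : IsClosed (I : Set A)] {a : A} (ha : a ∈ I) :
    star a ∈ I := by
  change star a ∈ (I : Set A)
  rw [← hI.closure_eq, Metric.mem_closure_iff]
  intro ε hε
  obtain ⟨g, r, h1, -, -, h2⟩ := exists_approx (star a) (half_pos hε)
  rw [star_star] at h1
  refine ⟨star a * (1 - r), I.mul_mem_left _ ?_, ?_⟩
  · rw [h1]
    exact I.mul_mem_left _ (I.mul_mem_right _ ha)
  · rw [dist_eq_norm, mul_sub, mul_one, sub_sub_cancel]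
    exact lt_of_le_of_lt h2 (half_lt_self hε)

instance isTwoSided_sup [I.IsTwoSided] [J.IsTwoSided] : (I ⊔ J).IsTwoSided where
  mul_mem_of_left b ha := by
    obtain ⟨x, hx, y, hy, rfl⟩ := Submodule.mem_sup.1 ha
    rw [add_mul]
    exact add_mem (Submodule.mem_sup_left (I.mul_mem_right _ hx))
      (Submodule.mem_sup_right (J.mul_mem_right _ hy))

/-- Sums of two closed two-sided ideals of `C*`-algebras are closed. -/
theorem isClosed_sup [I.IsTwoSided] [J.IsTwoSided] [hI : IsClosed (I : Set A)]
    [hJ : IsClosed (J : Set A)] : IsClosed ((I ⊔ J : Ideal A) : Set A) := by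
  have : CompleteSpace J.toAddSubgroup := hJ.completeSpace_coe
  let f : NormedAddGroupHom J.toAddSubgroup (A ⧸ I) :=
    AddMonoidHom.mkNormedAddGroupHom
      ((Submodule.mkQ I).toAddMonoidHom.comp J.toAddSubgroup.subtype) 1 fun x => by
        rw [one_mul]
        exact Submodule.Quotient.norm_mk_le (S := I) (x : A)
  have hf : ∀ x : J.toAddSubgroup, f x = Submodule.Quotient.mk (x : A) := fun x => rfl
  let K : AddSubgroup (A ⧸ I) := f.range
  have hK : f.SurjectiveOnWith K 5 := by
    rintro _ ⟨j, rfl⟩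
    rcases (norm_nonneg (f j)).eq_or_lt with h0 | h0
    · exact ⟨0, by rw [map_zero]; exact (norm_eq_zero.1 h0.symm).symm, by simp⟩
    obtain ⟨c, hc, hcn⟩ := Submodule.Quotient.norm_mk_lt (S := I) (f j) h0
    obtain ⟨g, r, h1, -, h2, h3⟩ := exists_approx (j : A) h0
    have hy : (j : A) - c ∈ I := (Submodule.Quotient.eq I).1 ((hf j).symm.trans hc.symm)
    have hr : ∀ a : A, a * (1 - r) ∈ J := sub_mul_mem J j.2 h1
    refine ⟨⟨j - (j - c) * (1 - r), J.sub_mem j.2 (hr _)⟩, ?_, ?_⟩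
    · change f _ = f j
      rw [hf, hf]
      refine (Submodule.Quotient.eq I).2 ?_
      rw [sub_sub_cancel_left]
      exact I.neg_mem (I.mul_mem_right _ hy)
    · have h4 : (j : A) - (j - c) * (1 - r) = j * r + (c - c * r) := by noncomm_ring
      change ‖(j : A) - (j - c) * (1 - r)‖ ≤ _
      rw [h4]
      calc ‖(j : A) * r + (c - c * r)‖ ≤ ‖(j : A) * r‖ + (‖c‖ + ‖c * r‖) :=
            (norm_add_le _ _).trans (add_le_add_right (norm_sub_le _ _) _)
        _ ≤ ‖f j‖ + (‖c‖ + ‖c‖ * 1) := by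
            gcongr
            exact (norm_mul_le _ _).trans (mul_le_mul_of_nonneg_left h2 (norm_nonneg _))
        _ ≤ 5 * ‖f j‖ := by linarith
  have hK' := controlled_closure_of_complete (by norm_num) one_pos hK
  refine isClosed_of_closure_subset fun x hx => ?_
  have hcont : Continuous (fun a : A => (Submodule.Quotient.mk a : A ⧸ I)) :=
    continuous_quotient_mk'
  have hx' : (Submodule.Quotient.mk x : A ⧸ I) ∈ K.topologicalClosure := by
    refine closure_mono ?_ (image_closure_subset_closure_image hcont ⟨x, hx, rfl⟩)
    rintro _ ⟨y, hy, rfl⟩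
    obtain ⟨a, ha, b, hb, rfl⟩ := Submodule.mem_sup.1 hy
    refine ⟨⟨b, hb⟩, ((Submodule.Quotient.eq I).2 ?_)⟩
    change b - (a + b) ∈ I
    rw [sub_add_cancel_right]
    exact I.neg_mem ha
  obtain ⟨j, hj, -⟩ := hK' _ hx'
  have h := (Submodule.Quotient.eq I).1 ((hf j).symm.trans hj)
  have h2 : x = -((j : A) - x) + j := by abel
  rw [h2]
  exact add_mem (Submodule.mem_sup_left (I.neg_mem h)) (Submodule.mem_sup_right j.2)

variable {I J}

end Ideals

section Quotient

variable (I J : Ideal A) [I.IsTwoSided] [hI : IsClosed (I : Set A)] [J.IsTwoSided]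
  [hJ : IsClosed (J : Set A)]

theorem norm_lt_iff {x : A ⧸ I} {u : ℝ} :
    ‖x‖ < u ↔ ∃ a : A, Ideal.Quotient.mk I a = x ∧ ‖a‖ < u :=
  QuotientAddGroup.norm_lt_iff (S := I.toAddSubgroup)

theorem norm_mk_le (a : A) : ‖Ideal.Quotient.mk I a‖ ≤ ‖a‖ :=
  Submodule.Quotient.norm_mk_le (S := I) a

/-- The quotient of a `C*`-algebra by a closed two-sided ideal, with the quotient norm. -/
instance : NormedRing (A ⧸ I) where
  __ := (inferInstance : Ring (A ⧸ I))
  __ := (inferInstance : NormedAddCommGroup (A ⧸ I))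
  norm_mul_le x y := by
    refine le_mul_of_forall_lt₀ fun u hu v hv => ?_
    obtain ⟨a, rfl, ha⟩ := (norm_lt_iff I).1 hu
    obtain ⟨b, rfl, hb⟩ := (norm_lt_iff I).1 hv
    rw [← map_mul]
    refine (norm_mk_le I _).trans ((norm_mul_le a b).trans ?_)
    exact mul_le_mul ha.le hb.le (norm_nonneg _) ((norm_nonneg _).trans ha.le)

instance : StarRing (A ⧸ I) where
  star := Quotient.map' star fun a b h => by
    have h' : a - b ∈ I := (Submodule.quotientRel_def I).1 h
    refine (Submodule.quotientRel_def I).2 ?_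
    rw [← star_sub]
    exact star_mem I h'
  star_involutive := by
    rintro ⟨a⟩
    exact congrArg (Ideal.Quotient.mk I) (star_star a)
  star_mul := by
    rintro ⟨a⟩ ⟨b⟩
    exact congrArg (Ideal.Quotient.mk I) (star_mul a b)
  star_add := by
    rintro ⟨a⟩ ⟨b⟩
    exact congrArg (Ideal.Quotient.mk I) (star_add a b)

theorem star_mk (a : A) : star (Ideal.Quotient.mk I a) = Ideal.Quotient.mk I (star a) := rfl

theorem norm_mul_self_le (x : A ⧸ I) : ‖x‖ * ‖x‖ ≤ ‖star x * x‖ := by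
  obtain ⟨a, rfl⟩ := Ideal.Quotient.mk_surjective x
  refine le_of_forall_gt fun u hu => ?_
  obtain ⟨v, hv, hvu⟩ := exists_between hu
  rw [star_mk, ← map_mul] at hv
  obtain ⟨c, hc, hcv⟩ := (norm_lt_iff I).1 hv
  have hy : c - star a * a ∈ I := Ideal.Quotient.eq.1 hc
  obtain ⟨g, r, h1, h2, h3, h4⟩ := exists_approx (c - star a * a) (sub_pos.2 hvu)
  have h5 : Ideal.Quotient.mk I a = Ideal.Quotient.mk I (a * r) := by
    refine Ideal.Quotient.eq.2 ?_
    have := sub_mul_mem I hy h1 a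
    rwa [mul_sub, mul_one] at this
  have h6 : ‖Ideal.Quotient.mk I a‖ ≤ ‖a * r‖ := h5 ▸ norm_mk_le I (a * r)
  have h7 : star a * a * r = c * r - (c - star a * a) * r := by noncomm_ring
  calc ‖Ideal.Quotient.mk I a‖ * ‖Ideal.Quotient.mk I a‖
      ≤ ‖a * r‖ * ‖a * r‖ := mul_self_le_mul_self (norm_nonneg _) h6
    _ = ‖r * (star a * a * r)‖ := by
        rw [← CStarRing.norm_star_mul_self, star_mul, h2]
        simp only [mul_assoc]
    _ ≤ 1 * ‖star a * a * r‖ :=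
        (norm_mul_le _ _).trans (mul_le_mul_of_nonneg_right h3 (norm_nonneg _))
    _ ≤ ‖c * r‖ + ‖(c - star a * a) * r‖ := by
        rw [one_mul, h7]
        exact norm_sub_le _ _
    _ ≤ ‖c‖ * 1 + (u - v) :=
        add_le_add ((norm_mul_le _ _).trans
          (mul_le_mul_of_nonneg_left h3 (norm_nonneg _))) h4
    _ < u := by linarith

instance : CStarAlgebra (A ⧸ I) where
  toCompleteSpace := Submodule.Quotient.completeSpace I
  norm_mul_self_le := norm_mul_self_le I
  norm_smul_le c x := (Submodule.Quotient.normedSpace I ℂ).norm_smul_le c x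
  star_smul c := by
    rintro ⟨a⟩
    exact congrArg (Ideal.Quotient.mk I) (star_smul c a)

/-- The quotient map. -/
def mk : A →⋆ₐ[ℂ] A ⧸ I :=
  { Ideal.Quotient.mk I with
    commutes' := fun _ => rfl
    map_star' := fun _ => rfl }

theorem mk_surjective : Function.Surjective (mk I) := Ideal.Quotient.mk_surjective

variable {I J}

theorem mk_eq_mk {a b : A} : mk I a = mk I b ↔ a - b ∈ I := Ideal.Quotient.eq

/-- The homomorphism of quotients induced by a homomorphism which maps `I` into `J`. -/
def map {A' : Type*} [CStarAlgebra A'] {J : Ideal A'} [J.IsTwoSided]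
    [IsClosed (J : Set A')] (f : A →⋆ₐ[ℂ] A') (h : ∀ a ∈ I, f a ∈ J) : A ⧸ I →⋆ₐ[ℂ] A' ⧸ J :=
  { Ideal.Quotient.lift I ((Ideal.Quotient.mk J).comp (f : A →+* A'))
      fun a ha => Ideal.Quotient.eq_zero_iff_mem.2 (h a ha) with
    commutes' := fun c => congrArg (Ideal.Quotient.mk J) (AlgHomClass.commutes f c)
    map_star' := by
      rintro ⟨a⟩
      exact congrArg (Ideal.Quotient.mk J) (map_star f a) }

@[simp]
theorem map_mk {A' : Type*} [CStarAlgebra A'] {J : Ideal A'} [J.IsTwoSided]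
    [IsClosed (J : Set A')] (f : A →⋆ₐ[ℂ] A') (h : ∀ a ∈ I, f a ∈ J) (a : A) :
    map f h (mk I a) = mk J (f a) := rfl

/-- The natural map `A / I → A / J` for closed two-sided ideals `I ≤ J`. -/
def factor (h : I ≤ J) : A ⧸ I →⋆ₐ[ℂ] A ⧸ J := map (StarAlgHom.id ℂ A) h

@[simp]
theorem factor_mk (h : I ≤ J) (a : A) : factor h (mk I a) = mk J a := rfl

theorem factor_surjective (h : I ≤ J) : Function.Surjective (factor h) := fun x => by
  obtain ⟨a, rfl⟩ := mk_surjective J x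
  exact ⟨mk I a, rfl⟩

end Quotient

section Generated

/-- The closed two-sided ideal generated by an element. -/
def closedIdeal (x : A) : Ideal A :=
  sInf {I : Ideal A | I.IsTwoSided ∧ IsClosed (I : Set A) ∧ x ∈ I}

theorem mem_closedIdeal (x : A) : x ∈ closedIdeal x :=
  Submodule.mem_sInf.2 fun _ hI => hI.2.2

theorem closedIdeal_le {x : A} {I : Ideal A} [h : I.IsTwoSided] (hI : IsClosed (I : Set A))
    (hx : x ∈ I) : closedIdeal x ≤ I := sInf_le ⟨h, hI, hx⟩

instance (x : A) : (closedIdeal x).IsTwoSided where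
  mul_mem_of_left b ha := Submodule.mem_sInf.2 fun I hI => by
    have := hI.1
    exact Ideal.mul_mem_right b I (Submodule.mem_sInf.1 ha I hI)

instance (x : A) : IsClosed (closedIdeal x : Set A) := by
  rw [closedIdeal, Submodule.coe_sInf]
  exact isClosed_biInter fun I hI => hI.2.1

end Generated

end CStarQuotient

/-! ### Multipullbacks and the cocycle condition

A family of homomorphisms `π^i_j : A_i → A_ij` with `A_ij = A_ji` is indexed by unordered pairs:
`A₂ s(i, j)` is `A_ij`, and `π s(i, j) i _ : A i → A₂ s(i, j)` is `π^i_j`, whereas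
`π s(i, j) j _ : A j → A₂ s(i, j)` is `π^j_i`. -/

section Multipullback

variable {J : Type*} {A : J → Type*} {A₂ : Sym2 J → Type*} [∀ i, CStarAlgebra (A i)]
  [∀ p, CStarAlgebra (A₂ p)] (π : ∀ (p : Sym2 J) (i : J), i ∈ p → (A i →⋆ₐ[ℂ] A₂ p))

/-- The multipullback of the `A i` over the homomorphisms `π`. -/
def multipullback : StarSubalgebra ℂ (∀ i, A i) where
  carrier := {b | ∀ i j : J, i ≠ j →
    π s(i, j) i (Sym2.mem_mk_left i j) (b i) = π s(i, j) j (Sym2.mem_mk_right i j) (b j)}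
  mul_mem' ha hb i j h := by simp only [Pi.mul_apply, map_mul, ha i j h, hb i j h]
  one_mem' i j h := by simp only [Pi.one_apply, map_one]
  add_mem' ha hb i j h := by simp only [Pi.add_apply, map_add, ha i j h, hb i j h]
  zero_mem' i j h := by simp only [Pi.zero_apply, map_zero]
  algebraMap_mem' c i j h := by simp only [Pi.algebraMap_apply, AlgHomClass.commutes]
  star_mem' ha i j h := by simp only [Pi.star_apply, map_star, ha i j h]

instance [Fintype J] : IsClosed (multipullback π : Set (∀ i, A i)) := by
  have h : (multipullback π : Set (∀ i, A i)) = ⋂ (i : J) (j : J) (_ : i ≠ j), {b |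
      π s(i, j) i (Sym2.mem_mk_left i j) (b i)
        = π s(i, j) j (Sym2.mem_mk_right i j) (b j)} := by
    ext b
    simp only [Set.mem_iInter]
    rfl
  rw [h]
  refine isClosed_iInter fun i => isClosed_iInter fun j => isClosed_iInter fun _ => ?_
  exact isClosed_eq ((continuous_starAlgHom _).comp (continuous_apply i))
    ((continuous_starAlgHom _).comp (continuous_apply j))

end Multipullback

section Cocycle

variable {A A' B C D : Type*} [CStarAlgebra A] [CStarAlgebra A'] [CStarAlgebra B]
  [CStarAlgebra C] [CStarAlgebra D]

/-- The image of an ideal under a surjective homomorphism. -/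
def imageIdeal (f : A →⋆ₐ[ℂ] B) (hf : Function.Surjective f) (I : Ideal A) : Ideal B where
  carrier := f '' I
  add_mem' := by
    rintro _ _ ⟨a, ha, rfl⟩ ⟨b, hb, rfl⟩
    exact ⟨a + b, I.add_mem ha hb, map_add f a b⟩
  zero_mem' := ⟨0, I.zero_mem, map_zero f⟩
  smul_mem' := by
    rintro c _ ⟨a, ha, rfl⟩
    obtain ⟨c, rfl⟩ := hf c
    exact ⟨c * a, I.mul_mem_left c ha, map_mul f c a⟩

instance (f : A →⋆ₐ[ℂ] B) (hf : Function.Surjective f) (I : Ideal A) [I.IsTwoSided] :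
    (imageIdeal f hf I).IsTwoSided where
  mul_mem_of_left c := by
    rintro ⟨a, ha, rfl⟩
    obtain ⟨c, rfl⟩ := hf c
    exact ⟨a * c, I.mul_mem_right c ha, map_mul f a c⟩

theorem map_mem_imageIdeal_iff (f : A →⋆ₐ[ℂ] B) (hf : Function.Surjective f) (I : Ideal A)
    (a : A) : f a ∈ imageIdeal f hf I ↔ a ∈ RingHom.ker f ⊔ I := by
  constructor
  · rintro ⟨b, hb, h⟩
    refine Submodule.mem_sup.2 ⟨a - b, ?_, b, hb, by abel⟩
    rw [RingHom.mem_ker, map_sub, h, sub_self]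
  · intro h
    obtain ⟨x, hx, y, hy, rfl⟩ := Submodule.mem_sup.1 h
    exact ⟨y, hy, by rw [map_add, (RingHom.mem_ker).1 hx, zero_add]⟩

/-- For `f = π^i_j` and `g = π^i_k`, this is the isomorphism
`π^{ij}_k : A_i / (ker π^i_j + ker π^i_k) → A_ij / π^i_j (ker π^i_k)`,
`[b] ↦ π^i_j b + π^i_j (ker π^i_k)`. -/
def quotientIso (f : A →⋆ₐ[ℂ] B) (g : A →⋆ₐ[ℂ] C) (hf : Function.Surjective f) :
    A ⧸ (RingHom.ker f ⊔ RingHom.ker g) ≃+* B ⧸ imageIdeal f hf (RingHom.ker g) :=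
  RingEquiv.ofBijective
    (Ideal.Quotient.lift (RingHom.ker f ⊔ RingHom.ker g)
      ((Ideal.Quotient.mk (imageIdeal f hf (RingHom.ker g))).comp (f : A →+* B))
      fun a ha => Ideal.Quotient.eq_zero_iff_mem.2 ((map_mem_imageIdeal_iff f hf _ a).2 ha))
    ⟨(injective_iff_map_eq_zero _).2 fun x => by
      obtain ⟨a, rfl⟩ := Ideal.Quotient.mk_surjective x
      intro h
      exact Ideal.Quotient.eq_zero_iff_mem.2
        ((map_mem_imageIdeal_iff f hf _ a).1 (Ideal.Quotient.eq_zero_iff_mem.1 h)),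
     fun y => by
      obtain ⟨b, rfl⟩ := Ideal.Quotient.mk_surjective y
      obtain ⟨a, rfl⟩ := hf b
      exact ⟨Ideal.Quotient.mk _ a, rfl⟩⟩

/-- For `f = π^i_j`, `g = π^i_k`, `f' = π^j_i` and `g' = π^j_k`, this is the isomorphism
`φ^{ij}_k = (π^{ij}_k)⁻¹ ∘ π^{ji}_k` from `A_j / (ker π^j_i + ker π^j_k)` to
`A_i / (ker π^i_j + ker π^i_k)`; it makes sense if `π^i_j (ker π^i_k) = π^j_i (ker π^j_k)`. -/
def transition (f : A →⋆ₐ[ℂ] B) (g : A →⋆ₐ[ℂ] C) (f' : A' →⋆ₐ[ℂ] B) (g' : A' →⋆ₐ[ℂ] D)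
    (hf : Function.Surjective f) (hf' : Function.Surjective f')
    (h : imageIdeal f hf (RingHom.ker g) = imageIdeal f' hf' (RingHom.ker g')) :
    A' ⧸ (RingHom.ker f' ⊔ RingHom.ker g') ≃+* A ⧸ (RingHom.ker f ⊔ RingHom.ker g) :=
  ((quotientIso f' g' hf').trans (Ideal.quotEquivOfEq h.symm)).trans (quotientIso f g hf).symm

/-- The identification of `A / (I + J)` with `A / (J + I)`. -/
def quotientSwap (I J : Ideal A) [I.IsTwoSided] [J.IsTwoSided] : A ⧸ (I ⊔ J) ≃+* A ⧸ (J ⊔ I) :=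
  Ideal.quotEquivOfEq (sup_comm I J)

end Cocycle

/-- The cocycle condition for a family `π` of surjective homomorphisms. Here `p`, `q` and `r` are
the pairs `s(i, j)`, `s(i, k)` and `s(j, k)`. -/
structure CocycleCondition {J : Type*} {A : J → Type*} {A₂ : Sym2 J → Type*}
    [∀ i, CStarAlgebra (A i)] [∀ p, CStarAlgebra (A₂ p)]
    (π : ∀ (p : Sym2 J) (i : J), i ∈ p → (A i →⋆ₐ[ℂ] A₂ p)) : Prop where
  surjective : ∀ p i hi, Function.Surjective (π p i hi)
  image_ker : ∀ (i j k : J), i ≠ j → i ≠ k → j ≠ k → ∀ (p q r : Sym2 J)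
    (hip : i ∈ p) (hjp : j ∈ p) (hiq : i ∈ q) (_ : k ∈ q) (hjr : j ∈ r) (_ : k ∈ r),
    imageIdeal (π p i hip) (surjective p i hip) (RingHom.ker (π q i hiq))
      = imageIdeal (π p j hjp) (surjective p j hjp) (RingHom.ker (π r j hjr))
  transition_eq : ∀ (i j k : J) (hij : i ≠ j) (hik : i ≠ k) (hjk : j ≠ k) (p q r : Sym2 J)
    (hip : i ∈ p) (hjp : j ∈ p) (hiq : i ∈ q) (hkq : k ∈ q) (hjr : j ∈ r) (hkr : k ∈ r),
    let φijk := transition (π p i hip) (π q i hiq) (π p j hjp) (π r j hjr) (surjective p i hip)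
      (surjective p j hjp) (image_ker i j k hij hik hjk p q r hip hjp hiq hkq hjr hkr)
    let φikj := transition (π q i hiq) (π p i hip) (π q k hkq) (π r k hkr) (surjective q i hiq)
      (surjective q k hkq) (image_ker i k j hik hij hjk.symm q p r hiq hkq hip hjp hkr hjr)
    let φjki := transition (π r j hjr) (π p j hjp) (π r k hkr) (π q k hkq) (surjective r j hjr)
      (surjective r k hkr) (image_ker j k i hjk hij.symm hik.symm r p q hjr hkr hjp hip hkq hiq)
    ∀ x, quotientSwap _ _ (φikj x)
      = φijk (quotientSwap _ _ (φjki (quotientSwap _ _ x)))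

/-! ### Quantum balls and spheres -/

namespace QuantumSphere

open FreeStarAlgebra CStarQuotient

variable {N : ℕ} (θ : Matrix (Fin (N + 1)) (Fin (N + 1)) ℝ)

/-- The phase `e^{2πit}`. -/
def phase (t : ℝ) : ℂ := Complex.exp (2 * Real.pi * Complex.I * t)

/-- The relations `w_j w_k = e^{2πiθ_jk} w_k w_j` and `w_j* w_k = e^{-2πiθ_jk} w_k w_j*` for
`j ≠ k`. -/
def toeplitzRelations : Set (FreeStarAlgebra (Fin (N + 1))) :=
  {r | ∃ j k : Fin (N + 1), j ≠ k ∧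
    (r = gen j * gen k - phase (θ j k) • (gen k * gen j) ∨
      r = star (gen j) * gen k - phase (-θ j k) • (gen k * star (gen j)))}

/-- The twisted Toeplitz algebra. -/
abbrev TwistedToeplitz : Type := UniversalCStar (toeplitzRelations θ)

/-- The generating isometries of the twisted Toeplitz algebra. -/
abbrev w (i : Fin (N + 1)) : TwistedToeplitz θ := UniversalCStar.of (toeplitzRelations θ) i

/-- The closed two-sided ideal `I_i` generated by `1 - w_i w_i*`. -/
abbrev idealI (i : Fin (N + 1)) : Ideal (TwistedToeplitz θ) :=
  closedIdeal (1 - w θ i * star (w θ i))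

/-- The ideal `I_ij = I_i + I_j`. -/
def pairIdeal (p : Sym2 (Fin (N + 1))) : Ideal (TwistedToeplitz θ) :=
  Sym2.lift ⟨fun i j => idealI θ i ⊔ idealI θ j, fun _ _ => sup_comm _ _⟩ p

instance (p : Sym2 (Fin (N + 1))) : (pairIdeal θ p).IsTwoSided := by
  induction p with
  | _ i j => exact isTwoSided_sup (idealI θ i) (idealI θ j)

instance (p : Sym2 (Fin (N + 1))) : IsClosed (pairIdeal θ p : Set (TwistedToeplitz θ)) := by
  induction p with
  | _ i j => exact isClosed_sup (idealI θ i) (idealI θ j)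

theorem idealI_le_pairIdeal {p : Sym2 (Fin (N + 1))} {i : Fin (N + 1)} (h : i ∈ p) :
    idealI θ i ≤ pairIdeal θ p := by
  induction p with
  | _ j k =>
    rcases Sym2.mem_iff.1 h with rfl | rfl
    · exact le_sup_left
    · exact le_sup_right

/-- The quantum solid torus `B_i = T / I_i`. -/
abbrev B (i : Fin (N + 1)) : Type := TwistedToeplitz θ ⧸ idealI θ i

/-- The algebra `B_ij = T / (I_i + I_j)`. -/
abbrev B₂ (p : Sym2 (Fin (N + 1))) : Type := TwistedToeplitz θ ⧸ pairIdeal θ p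

/-- The quotient map `σ_i : T → B_i`. -/
abbrev σ (i : Fin (N + 1)) : TwistedToeplitz θ →⋆ₐ[ℂ] B θ i := CStarQuotient.mk (idealI θ i)

/-- The quotient maps `π^i_j : B_i → B_ij`, where `p` is the pair of `i` and `j`. -/
def π (p : Sym2 (Fin (N + 1))) (i : Fin (N + 1)) (h : i ∈ p) : B θ i →⋆ₐ[ℂ] B₂ θ p :=
  factor (idealI_le_pairIdeal θ h)

@[simp]
theorem π_σ (p : Sym2 (Fin (N + 1))) (i : Fin (N + 1)) (h : i ∈ p) (a : TwistedToeplitz θ) :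
    π θ p i h (σ θ i a) = CStarQuotient.mk (pairIdeal θ p) a := rfl

/-- The algebra `C(S^{2N+1}_{H,θ})` of the twisted Heegaard quantum sphere, as a closed
`*`-subalgebra of the direct sum of the `B_i`. -/
def heegaardSphere : StarSubalgebra ℂ (∀ i, B θ i) := multipullback (π θ)

instance : IsClosed (heegaardSphere θ : Set (∀ i, B θ i)) :=
  inferInstanceAs (IsClosed (multipullback (π θ) : Set (∀ i, B θ i)))

/-- The elements `𝐬_i = (σ_0(w_i), …, σ_N(w_i))` of the algebra of the quantum sphere. -/
def sphereGen (i : Fin (N + 1)) : heegaardSphere θ := 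
  ⟨fun k => σ θ k (w θ i), fun j k _ => (π_σ θ s(j, k) j _ _).trans (π_σ θ s(j, k) k _ _).symm⟩

theorem toeplitz_relation {j k : Fin (N + 1)} (h : j ≠ k) :
    w θ j * w θ k = phase (θ j k) • (w θ k * w θ j) := by
  have := UniversalCStar.eval_of_eq_zero (R := toeplitzRelations θ) ⟨j, k, h, Or.inl rfl⟩
  simpa [sub_eq_zero] using this

theorem toeplitz_relation_star {j k : Fin (N + 1)} (h : j ≠ k) :
    star (w θ j) * w θ k = phase (-θ j k) • (w θ k * star (w θ j)) := by
  have := UniversalCStar.eval_of_eq_zero (R := toeplitzRelations θ) ⟨j, k, h, Or.inr rfl⟩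
  simpa [sub_eq_zero] using this

theorem star_mul_circle (z : Circle) : star (z : ℂ) * z = 1 := by
  have := Circle.normSq_coe z
  rw [Complex.star_def, ← Complex.normSq_eq_conj_mul_self, this]
  simp

/-- The endomorphism `w_j ↦ z_j w_j` of the twisted Toeplitz algebra. -/
def gaugeHom (z : Fin (N + 1) → Circle) : TwistedToeplitz θ →⋆ₐ[ℂ] TwistedToeplitz θ :=
  UniversalCStar.lift (fun j => (z j : ℂ) • w θ j)
    (fun j => by
      rw [star_smul, smul_mul_smul_comm, UniversalCStar.star_of_mul_of, star_mul_circle,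
        one_smul])
    (by
      rintro r ⟨j, k, h, rfl | rfl⟩
      · simp only [map_sub, map_mul, map_smul, eval_gen, smul_mul_smul_comm,
          toeplitz_relation θ h]
        rw [sub_eq_zero, smul_comm, mul_comm]
      · simp only [map_sub, map_mul, map_smul, map_star, eval_gen, star_smul,
          smul_mul_smul_comm, toeplitz_relation_star θ h]
        rw [sub_eq_zero, smul_comm, mul_comm])

@[simp]
theorem gaugeHom_w (z : Fin (N + 1) → Circle) (j : Fin (N + 1)) :
    gaugeHom θ z (w θ j) = (z j : ℂ) • w θ j := UniversalCStar.lift_of ..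

theorem gaugeHom_one : gaugeHom θ 1 = StarAlgHom.id ℂ _ :=
  UniversalCStar.hom_ext fun j => by
    rw [gaugeHom_w]
    simp

theorem gaugeHom_mul (z z' : Fin (N + 1) → Circle) :
    gaugeHom θ (z * z') = (gaugeHom θ z).comp (gaugeHom θ z') :=
  UniversalCStar.hom_ext fun j => by
    rw [gaugeHom_w, StarAlgHom.comp_apply, gaugeHom_w, map_smul, gaugeHom_w, smul_smul,
      Pi.mul_apply, Circle.coe_mul, mul_comm]

theorem gaugeHom_mem (z : Fin (N + 1) → Circle) (i : Fin (N + 1)) :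
    ∀ a ∈ idealI θ i, gaugeHom θ z a ∈ idealI θ i := by
  refine closedIdeal_le (I := (idealI θ i).comap (gaugeHom θ z)) ?_ ?_
  · exact IsClosed.preimage (continuous_starAlgHom _)
      (inferInstance : IsClosed (idealI θ i : Set (TwistedToeplitz θ)))
  · rw [Ideal.mem_comap, map_sub, map_one, map_mul, map_star, gaugeHom_w, star_smul,
      smul_mul_smul_comm, mul_comm, star_mul_circle, one_smul]
    exact mem_closedIdeal _

theorem gaugeHom_mem_pair (z : Fin (N + 1) → Circle) (p : Sym2 (Fin (N + 1))) :
    ∀ a ∈ pairIdeal θ p, gaugeHom θ z a ∈ pairIdeal θ p := by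
  induction p with
  | _ i j =>
    intro a ha
    obtain ⟨x, hx, y, hy, rfl⟩ := Submodule.mem_sup.1 ha
    rw [map_add]
    exact add_mem (Submodule.mem_sup_left (gaugeHom_mem θ z i x hx))
      (Submodule.mem_sup_right (gaugeHom_mem θ z j y hy))

/-- The gauge endomorphism on `B_i`. -/
def gaugeB (z : Fin (N + 1) → Circle) (i : Fin (N + 1)) : B θ i →⋆ₐ[ℂ] B θ i :=
  CStarQuotient.map (gaugeHom θ z) (gaugeHom_mem θ z i)

/-- The gauge endomorphism on `B_ij`. -/
def gaugeB₂ (z : Fin (N + 1) → Circle) (p : Sym2 (Fin (N + 1))) : B₂ θ p →⋆ₐ[ℂ] B₂ θ p :=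
  CStarQuotient.map (gaugeHom θ z) (gaugeHom_mem_pair θ z p)

theorem π_gaugeB (z : Fin (N + 1) → Circle) (p : Sym2 (Fin (N + 1))) (i : Fin (N + 1))
    (h : i ∈ p) (b : B θ i) : π θ p i h (gaugeB θ z i b) = gaugeB₂ θ z p (π θ p i h b) := by
  obtain ⟨a, rfl⟩ := CStarQuotient.mk_surjective _ b
  rfl

theorem gaugeB_one (i : Fin (N + 1)) (b : B θ i) : gaugeB θ 1 i b = b := by
  obtain ⟨a, rfl⟩ := CStarQuotient.mk_surjective _ b
  rw [gaugeB, CStarQuotient.map_mk, gaugeHom_one]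
  rfl

theorem gaugeB_mul (z z' : Fin (N + 1) → Circle) (i : Fin (N + 1)) (b : B θ i) :
    gaugeB θ (z * z') i b = gaugeB θ z i (gaugeB θ z' i b) := by
  obtain ⟨a, rfl⟩ := CStarQuotient.mk_surjective _ b
  simp only [gaugeB, CStarQuotient.map_mk, gaugeHom_mul]
  rfl

/-- The gauge endomorphism `(b_0, …, b_N) ↦ (z · b_0, …, z · b_N)` on the algebra of the quantum
sphere. -/
def gaugeSphere (z : Fin (N + 1) → Circle) : heegaardSphere θ →⋆ₐ[ℂ] heegaardSphere θ where
  toFun b := ⟨fun i => gaugeB θ z i (b.1 i), fun i j h => by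
    rw [π_gaugeB, π_gaugeB, b.2 i j h]⟩
  map_one' := Subtype.ext (funext fun i => map_one (gaugeB θ z i))
  map_mul' a b := Subtype.ext (funext fun i => map_mul (gaugeB θ z i) (a.1 i) (b.1 i))
  map_zero' := Subtype.ext (funext fun i => map_zero (gaugeB θ z i))
  map_add' a b := Subtype.ext (funext fun i => map_add (gaugeB θ z i) (a.1 i) (b.1 i))
  commutes' c := Subtype.ext (funext fun i => AlgHomClass.commutes (gaugeB θ z i) c)
  map_star' a := Subtype.ext (funext fun i => map_star (gaugeB θ z i) (a.1 i))

theorem gaugeSphere_one : gaugeSphere θ 1 = StarAlgHom.id ℂ _ := by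
  ext b : 1
  exact Subtype.ext (funext fun i => gaugeB_one θ i (b.1 i))

theorem gaugeSphere_mul (z z' : Fin (N + 1) → Circle) :
    gaugeSphere θ (z * z') = (gaugeSphere θ z).comp (gaugeSphere θ z') := by
  ext b : 1
  exact Subtype.ext (funext fun i => gaugeB_mul θ z z' i (b.1 i))

/-- The gauge action of `U(1)^{N+1}` on the algebra of the quantum sphere. -/
def gaugeAction : (Fin (N + 1) → Circle) →* (heegaardSphere θ ≃⋆ₐ[ℂ] heegaardSphere θ) where
  toFun z := StarAlgEquiv.ofStarAlgHom (gaugeSphere θ z) (gaugeSphere θ z⁻¹)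
    (by rw [← gaugeSphere_mul, inv_mul_cancel, gaugeSphere_one])
    (by rw [← gaugeSphere_mul, mul_inv_cancel, gaugeSphere_one])
  map_one' := by
    ext b : 1
    exact DFunLike.congr_fun (gaugeSphere_one θ) b
  map_mul' z z' := by
    ext b : 1
    exact DFunLike.congr_fun (gaugeSphere_mul θ z z') b

/-- The diagonal `U(1)`-action `α` on the algebra of the quantum sphere. -/
def α : Circle →* (heegaardSphere θ ≃⋆ₐ[ℂ] heegaardSphere θ) :=
  (gaugeAction θ).comp (Pi.constMonoidHom (Fin (N + 1)) Circle)

/-- The relations `s_i s_j = e^{2πiθ_ij} s_j s_i` and `s_i s_j* = e^{-2πiθ_ij} s_j* s_i` for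
`i ≠ j`, and the sphere equation `∏ (1 - s_i s_i*) = 0`. -/
def sphereRelations : Set (FreeStarAlgebra (Fin (N + 1))) :=
  {r | ∃ i j : Fin (N + 1), i ≠ j ∧
    (r = gen i * gen j - phase (θ i j) • (gen j * gen i) ∨
      r = gen i * star (gen j) - phase (-θ i j) • (star (gen j) * gen i))} ∪
  {(List.ofFn fun i : Fin (N + 1) => 1 - gen i * star (gen i)).prod}

/-- The universal `C*`-algebra `A_θ(N+1)`. -/
abbrev UniversalSphere : Type := UniversalCStar (sphereRelations θ)

/-- The generating isometries of `A_θ(N+1)`. -/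
abbrev s (i : Fin (N + 1)) : UniversalSphere θ := UniversalCStar.of (sphereRelations θ) i

end QuantumSphere

end

/-! Write T for the twisted Toeplitz algebra and p_i = 1 - w_i w_i* for its defects, so that I_i is
the closed ideal generated by p_i. Both A_θ(N+1) and the multipullback are identified with T / ⋂
I_i.

For the multipullback, consider the diagonal map T → ∏ T / I_i. Its kernel is ⋂ I_i. That it reaches
every compatible family is a Chinese remainder theorem, which holds because closed two-sided ideals
of a C*-algebra form a distributive lattice (`sup_inf_sup_le`, `exists_forall_sub_mem`).
Distributivity comes from approximate units: an element of I ∩ J is a limit of products of an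
element of I and an element of J (`mem_of_mul_mem`).

For A_θ(N+1), antisymmetry of θ shows that its commutation relations are those of T, so A_θ(N+1) is
T with the extra relation ∏ p_i = 0. What remains is that ∏ p_i generates ⋂ I_i
(`listInf_idealI_le`). This is proved one factor at a time. Let b be the product of the other
defects; it commutes with w_j and w_j*, while p_j commutes with w_k and w_k* for k ≠ j. Since
generators commute up to phases, a *-polynomial is a sum of products v u with v commuting with p_j
and u commuting with b. Then p_j v u b = v (p_j b) u lies in the ideal of p_j b, and by density p_j
x b does for every x in T. By `closedIdeal_inf_le`, this bounds the intersection of the ideals of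
p_j and b.

The action on A_θ(N+1) is the transport of α along the isomorphism. The cocycle condition is formal:
all algebras involved are quotients of T and all maps are induced by the identity of T, so each
transition isomorphism sends the class of an element of T to the class of the same element. -/

noncomputable section

/-! ### Closed ideals of C*-algebras: distributivity, Chinese remainders, generated ideals. -/

namespace CStarQuotient

variable {A : Type*} [CStarAlgebra A]

/-- In a `C*`-algebra, the intersection of two two-sided ideals lies in every closed ideal that
contains the products of their elements. -/
theorem mem_of_mul_mem {I J K : Ideal A} [I.IsTwoSided] [J.IsTwoSided]
    [hK : IsClosed (K : Set A)] (h : ∀ a ∈ I, ∀ b ∈ J, a * b ∈ K) {x : A} (hI : x ∈ I)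
    (hJ : x ∈ J) : x ∈ K := by
  change x ∈ (K : Set A)
  rw [← hK.closure_eq, Metric.mem_closure_iff]
  intro ε hε
  obtain ⟨g, r, h1, -, -, h2⟩ := exists_approx x (half_pos hε)
  -- Since 1 - r = g x* x, the approximant is the product of x ∈ I and g x* x ∈ J.
  refine ⟨x * (1 - r), ?_, ?_⟩
  · rw [h1]
    exact h _ hI _ (J.mul_mem_left _ (J.mul_mem_left _ hJ))
  · rw [dist_eq_norm, mul_sub, mul_one, sub_sub_cancel]
    exact lt_of_le_of_lt h2 (half_lt_self hε)

instance isTwoSided_inf (I J : Ideal A) [I.IsTwoSided] [J.IsTwoSided] : (I ⊓ J).IsTwoSided where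
  mul_mem_of_left _ ha := ⟨I.mul_mem_right _ ha.1, J.mul_mem_right _ ha.2⟩

theorem isClosed_inf (I J : Ideal A) [hI : IsClosed (I : Set A)] [hJ : IsClosed (J : Set A)] :
    IsClosed ((I ⊓ J : Ideal A) : Set A) := hI.inter hJ

/-- The lattice of closed two-sided ideals of a `C*`-algebra is distributive. -/
theorem sup_inf_sup_le (I J L : Ideal A) [I.IsTwoSided] [J.IsTwoSided] [L.IsTwoSided]
    [IsClosed (I : Set A)] [IsClosed (J : Set A)] [IsClosed (L : Set A)] :
    (I ⊔ L) ⊓ (J ⊔ L) ≤ I ⊓ J ⊔ L := by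
  have := isClosed_inf I J
  have := isClosed_sup (I ⊓ J) L
  rintro x ⟨hI, hJ⟩
  refine mem_of_mul_mem (I := I ⊔ L) (J := J ⊔ L) ?_ hI hJ
  intro a ha b hb
  obtain ⟨i, hi, l, hl, rfl⟩ := Submodule.mem_sup.1 ha
  obtain ⟨j, hj, m, hm, rfl⟩ := Submodule.mem_sup.1 hb
  -- (i + l)(j + m) = ij + (im + l(j + m)), with ij ∈ I ∩ J and the rest in L.
  rw [add_mul, mul_add, add_assoc]
  exact Submodule.add_mem_sup ⟨I.mul_mem_right _ hi, J.mul_mem_left _ hj⟩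
    (add_mem (L.mul_mem_left _ hm) (L.mul_mem_right _ hl))

/-- The intersection of the ideals in a list. -/
def listInf {ι : Type*} (I : ι → Ideal A) (l : List ι) : Ideal A :=
  l.foldr (fun i K => I i ⊓ K) ⊤

section ListInf

variable {ι : Type*} (I : ι → Ideal A)

theorem mem_listInf {l : List ι} {x : A} : x ∈ listInf I l ↔ ∀ i ∈ l, x ∈ I i := by
  induction l with
  | nil => simp [listInf]
  | cons j l ih =>
    rw [List.forall_mem_cons, ← ih]
    rfl

variable [∀ i, (I i).IsTwoSided] [hI : ∀ i, IsClosed (I i : Set A)]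

instance isTwoSided_listInf (l : List ι) : (listInf I l).IsTwoSided where
  mul_mem_of_left b ha := by
    rw [mem_listInf] at ha ⊢
    exact fun i hi => (I i).mul_mem_right _ (ha i hi)

instance isClosed_listInf (l : List ι) : IsClosed (listInf I l : Set A) := by
  have h : (listInf I l : Set A) = ⋂ i ∈ l, (I i : Set A) := by
    ext x
    simp [mem_listInf]
  rw [h]
  exact isClosed_biInter fun i _ => hI i

/-- Iterates `sup_inf_sup_le` along the list, starting from the empty intersection, which is the
whole algebra. This is where the Chinese remainder theorem uses distributivity. -/
theorem mem_listInf_sup (L : Ideal A) [L.IsTwoSided] [IsClosed (L : Set A)] {x : A}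
    {l : List ι} (h : ∀ i ∈ l, x ∈ I i ⊔ L) : x ∈ listInf I l ⊔ L := by
  induction l with
  | nil => exact Submodule.mem_sup_left trivial
  | cons j l ih =>
    rw [List.forall_mem_cons] at h
    exact sup_inf_sup_le (I j) (listInf I l) L ⟨h.1, ih h.2⟩

/-- The Chinese remainder theorem for closed two-sided ideals of a `C*`-algebra. -/
theorem exists_forall_sub_mem (t : ι → A) (l : List ι)
    (h : l.Pairwise fun i j => t i - t j ∈ I j ⊔ I i) :
    ∃ x, ∀ i ∈ l, x - t i ∈ I i := by
  induction l with
  | nil => exact ⟨0, by simp⟩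
  | cons j l ih =>
    rw [List.pairwise_cons] at h
    obtain ⟨x, hx⟩ := ih h.2
    have hm : x - t j ∈ listInf I l ⊔ I j := by
      refine mem_listInf_sup I (I j) fun i hi => ?_
      rw [← sub_sub_sub_cancel_right x (t j) (t i)]
      exact sub_mem (Submodule.mem_sup_left (hx i hi)) (h.1 i hi)
    obtain ⟨a, ha, b, hb, hab⟩ := Submodule.mem_sup.1 hm
    -- Subtracting a keeps the congruences already solved, since a lies in every I_i with i in l;
    -- the new error x - a - t_j is b ∈ I_j.
    rw [mem_listInf] at ha
    refine ⟨x - a, List.forall_mem_cons.2 ⟨?_, fun i hi => ?_⟩⟩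
    · rwa [sub_right_comm, ← hab, add_sub_cancel_left]
    · rw [sub_right_comm]
      exact sub_mem (hx i hi) (ha i hi)

end ListInf

/-- If `a x b ∈ K` for all `x`, then the intersection of the closed ideals generated by `a` and
`b` lies in the closed ideal `K`. -/
theorem closedIdeal_inf_le {a b : A} {K : Ideal A} [K.IsTwoSided] [hK : IsClosed (K : Set A)]
    (h : ∀ x, a * x * b ∈ K) : closedIdeal a ⊓ closedIdeal b ≤ K := by
  -- Quantifying over x makes this left ideal stable under right multiplication as well, so it
  -- contains the whole closed ideal of a as soon as it contains a.
  let L : Ideal A :=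
    { carrier := {c | ∀ x, c * x * b ∈ K}
      add_mem' := fun hc hd x => by
        rw [add_mul, add_mul]
        exact add_mem (hc x) (hd x)
      zero_mem' := fun x => by simp
      smul_mem' := fun c d hd x => by
        rw [smul_eq_mul, mul_assoc, mul_assoc, ← mul_assoc d]
        exact K.mul_mem_left _ (hd x) }
  have : L.IsTwoSided := ⟨fun c hd x => by rw [mul_assoc _ c]; exact hd (c * x)⟩
  have hL : closedIdeal a ≤ L := by
    refine closedIdeal_le ?_ h
    change IsClosed {c | ∀ x, c * x * b ∈ K}
    simp only [Set.ofPred_forall]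
    exact isClosed_iInter fun x => hK.preimage (by fun_prop : Continuous fun c => c * x * b)
  -- The same argument in the second factor, now with c ranging over the closed ideal of a; that b
  -- belongs to M is `hL` at x = 1.
  let M : Ideal A :=
    { carrier := {d | ∀ c ∈ closedIdeal a, c * d ∈ K}
      add_mem' := fun hd he c hc => by
        rw [mul_add]
        exact add_mem (hd c hc) (he c hc)
      zero_mem' := fun x => by simp
      smul_mem' := fun d e he c hc => by
        rw [smul_eq_mul, ← mul_assoc]
        exact he _ ((closedIdeal a).mul_mem_right _ hc) }
  have : M.IsTwoSided := ⟨fun e hd c hc => by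
    rw [← mul_assoc]; exact K.mul_mem_right _ (hd c hc)⟩
  have hM : closedIdeal b ≤ M := by
    refine closedIdeal_le ?_ fun c hc => by simpa using hL hc 1
    change IsClosed {d | ∀ c ∈ closedIdeal a, c * d ∈ K}
    simp only [Set.ofPred_forall]
    exact isClosed_iInter fun c => isClosed_iInter fun _ =>
      hK.preimage (by fun_prop : Continuous fun d => c * d)
  rintro x ⟨hxa, hxb⟩
  exact mem_of_mul_mem (fun c hc d hd => hM hd c hc) hxa hxb

section Lift

variable {B : Type*} [CStarAlgebra B] {I : Ideal A} [I.IsTwoSided] [IsClosed (I : Set A)]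

/-- The homomorphism on a quotient induced by a homomorphism that vanishes on the ideal. -/
def lift (f : A →⋆ₐ[ℂ] B) (h : ∀ a ∈ I, f a = 0) : A ⧸ I →⋆ₐ[ℂ] B where
  toFun := Ideal.Quotient.lift I (f : A →+* B) h
  map_one' := map_one _
  map_mul' := map_mul _
  map_zero' := map_zero _
  map_add' := map_add _
  commutes' c := AlgHomClass.commutes f c
  map_star' := by
    rintro ⟨a⟩
    exact map_star f a

@[simp]
theorem lift_mk (f : A →⋆ₐ[ℂ] B) (h : ∀ a ∈ I, f a = 0) (a : A) : lift f h (mk I a) = f a := rfl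

end Lift

end CStarQuotient

/-! ### The intersection of the ideals I_i in the twisted Toeplitz algebra. -/

namespace QuantumSphere

open FreeStarAlgebra CStarQuotient

variable {N : ℕ} (θ : Matrix (Fin (N + 1)) (Fin (N + 1)) ℝ)

theorem phase_add (s t : ℝ) : phase (s + t) = phase s * phase t := by
  simp only [phase, ← Complex.exp_add]
  push_cast
  ring_nf

theorem phase_mul_phase_neg (t : ℝ) : phase t * phase (-t) = 1 := by
  rw [← phase_add, add_neg_cancel]
  simp [phase]

theorem phase_neg_mul_phase (t : ℝ) : phase (-t) * phase t = 1 := by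
  rw [mul_comm, phase_mul_phase_neg]

theorem star_phase (t : ℝ) : star (phase t) = phase (-t) := by
  simp only [phase, Complex.star_def, ← Complex.exp_conj, map_mul, Complex.conj_ofReal,
    Complex.conj_I, map_ofNat]
  push_cast
  ring_nf

/-- The defect projection `1 - w_i w_i*`. -/
def defect (i : Fin (N + 1)) : TwistedToeplitz θ := 1 - w θ i * star (w θ i)

theorem star_defect (i : Fin (N + 1)) : star (defect θ i) = defect θ i := by
  simp [defect]

/-- Moving w_k past w_i* and then past w_i yields opposite phases, which cancel. -/
theorem commute_defect_w {i k : Fin (N + 1)} (h : i ≠ k) : Commute (defect θ i) (w θ k) := by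
  refine (Commute.one_left _).sub_left ?_
  change w θ i * star (w θ i) * w θ k = w θ k * (w θ i * star (w θ i))
  rw [mul_assoc, toeplitz_relation_star θ h, mul_smul_comm, ← mul_assoc,
    toeplitz_relation θ h, smul_mul_assoc, smul_smul, phase_neg_mul_phase, one_smul, mul_assoc]

theorem commute_defect_star_w {i k : Fin (N + 1)} (h : i ≠ k) :
    Commute (defect θ i) (star (w θ k)) := by
  have := (commute_defect_w θ h).star_star
  rwa [star_defect] at this

theorem w_mul_star_w {j k : Fin (N + 1)} (h : j ≠ k) :
    w θ j * star (w θ k) = phase (θ k j) • (star (w θ k) * w θ j) := by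
  rw [toeplitz_relation_star θ h.symm, smul_smul, phase_mul_phase_neg, one_smul]

theorem star_w_mul_star_w {j k : Fin (N + 1)} (h : j ≠ k) :
    star (w θ j) * star (w θ k) = phase (-θ k j) • (star (w θ k) * star (w θ j)) := by
  rw [← star_mul, toeplitz_relation θ h.symm, star_smul, star_phase, star_mul]

/-- The algebra generated by the `w_k` and `w_k*` with `k ≠ j`. -/
def awayFrom (j : Fin (N + 1)) : Subalgebra ℂ (TwistedToeplitz θ) :=
  Algebra.adjoin ℂ {a | ∃ k, j ≠ k ∧ (a = w θ k ∨ a = star (w θ k))}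

theorem w_mem_awayFrom {j k : Fin (N + 1)} (h : j ≠ k) : w θ k ∈ awayFrom θ j :=
  Algebra.subset_adjoin ⟨k, h, Or.inl rfl⟩

theorem star_w_mem_awayFrom {j k : Fin (N + 1)} (h : j ≠ k) : star (w θ k) ∈ awayFrom θ j :=
  Algebra.subset_adjoin ⟨k, h, Or.inr rfl⟩

theorem commute_defect_of_mem_awayFrom {j : Fin (N + 1)} {v : TwistedToeplitz θ}
    (hv : v ∈ awayFrom θ j) : Commute (defect θ j) v := by
  induction hv using Algebra.adjoin_induction with
  | mem x hx =>
    obtain ⟨k, h, rfl | rfl⟩ := hx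
    · exact commute_defect_w θ h
    · exact commute_defect_star_w θ h
  | algebraMap c => exact (Algebra.commutes c _).symm
  | add x y _ _ hx hy => exact hx.add_right hy
  | mul x y _ _ hx hy => exact hx.mul_right hy

/-- The scalar depends on the generator, so moving a past a sum of words rescales its terms
differently; hence a new element v' instead of a multiple of v. It is applied with a = w_j and a =
w_j*. -/
theorem exists_mul_eq_mul_of_mem_awayFrom {j : Fin (N + 1)} {a v : TwistedToeplitz θ}
    (ha : ∀ k, j ≠ k → (∃ c : ℂ, a * w θ k = c • (w θ k * a)) ∧
      ∃ c : ℂ, a * star (w θ k) = c • (star (w θ k) * a))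
    (hv : v ∈ awayFrom θ j) : ∃ v' ∈ awayFrom θ j, a * v = v' * a := by
  induction hv using Algebra.adjoin_induction with
  | mem x hx =>
    obtain ⟨k, h, rfl | rfl⟩ := hx
    · obtain ⟨c, hc⟩ := (ha k h).1
      exact ⟨c • w θ k, Subalgebra.smul_mem _ (w_mem_awayFrom θ h) c, by
        rw [hc, smul_mul_assoc]⟩
    · obtain ⟨c, hc⟩ := (ha k h).2
      exact ⟨c • star (w θ k), Subalgebra.smul_mem _ (star_w_mem_awayFrom θ h) c, by
        rw [hc, smul_mul_assoc]⟩
  | algebraMap c => exact ⟨_, Subalgebra.algebraMap_mem _ c, (Algebra.commutes c _).symm⟩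
  | add x y _ _ hx hy =>
    obtain ⟨x', hx', hx⟩ := hx
    obtain ⟨y', hy', hy⟩ := hy
    exact ⟨x' + y', add_mem hx' hy', by rw [mul_add, add_mul, hx, hy]⟩
  | mul x y _ _ hx hy =>
    obtain ⟨x', hx', hx⟩ := hx
    obtain ⟨y', hy', hy⟩ := hy
    exact ⟨x' * y', mul_mem hx' hy', by rw [← mul_assoc, hx, mul_assoc, hy, mul_assoc]⟩

/-- If `b` commutes with `w_j` and `w_j*`, then every `*`-polynomial in the generators is a sum
of products of elements which commute with `1 - w_j w_j*` and elements which commute with `b`. -/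
theorem eval_mem_awayFrom_mul {j : Fin (N + 1)} {b : TwistedToeplitz θ} (hb : Commute b (w θ j))
    (hb' : Commute b (star (w θ j))) (f : FreeStarAlgebra (Fin (N + 1))) :
    eval (w θ) f ∈ Subalgebra.toSubmodule (awayFrom θ j) *
      Subalgebra.toSubmodule (Subalgebra.centralizer ℂ {b}) := by
  set C : Subalgebra ℂ (TwistedToeplitz θ) := Subalgebra.centralizer ℂ {b} with hC
  set M := Subalgebra.toSubmodule (awayFrom θ j) * Subalgebra.toSubmodule C with hM
  have hmemC : ∀ a, Commute b a → a ∈ C := fun a ha =>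
    (Subalgebra.mem_centralizer_iff ℂ).2 fun x hx => by
      rw [Set.mem_singleton_iff.1 hx]
      exact ha
  have h1 : ∀ a ∈ awayFrom θ j, ∀ m ∈ M, a * m ∈ M := fun a ha m hm => by
    induction hm using Submodule.mul_induction_on' with
    | mem_mul_mem v hv u hu =>
      rw [← mul_assoc]
      exact Submodule.mul_mem_mul (mul_mem ha hv : a * v ∈ awayFrom θ j) hu
    | add x _ y _ hx hy => rw [mul_add]; exact add_mem hx hy
  -- Such an a moves to the right through the first factor, which it twists, and is absorbed by the
  -- centralizer of b.
  have h2 : ∀ a, Commute b a → (∀ k, j ≠ k → (∃ c : ℂ, a * w θ k = c • (w θ k * a)) ∧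
      ∃ c : ℂ, a * star (w θ k) = c • (star (w θ k) * a)) → ∀ m ∈ M, a * m ∈ M :=
    fun a hba ha m hm => by
      induction hm using Submodule.mul_induction_on' with
      | mem_mul_mem v hv u hu =>
        obtain ⟨v', hv', h⟩ := exists_mul_eq_mul_of_mem_awayFrom θ ha hv
        rw [← mul_assoc, h, mul_assoc]
        exact Submodule.mul_mem_mul hv' (mul_mem (hmemC a hba) hu : a * u ∈ C)
      | add x _ y _ hx hy => rw [mul_add]; exact add_mem hx hy
  -- Stability of M under left multiplication passes to products of polynomials, which membership in
  -- M alone does not obviously do; the claim is the case m = 1.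
  have key : ∀ m ∈ M, eval (w θ) f * m ∈ M := by
    refine FreeStarAlgebra.induction (P := fun f => ∀ m ∈ M, eval (w θ) f * m ∈ M)
      ?_ ?_ ?_ ?_ f
    · intro c m hm
      rw [AlgHomClass.commutes, ← Algebra.smul_def]
      exact M.smul_mem c hm
    · rintro ⟨k, β⟩ m hm
      have hl : eval (w θ) (letter (k, β)) = if β then star (w θ k) else w θ k := by
        cases β
        · exact eval_gen _ _
        · rw [letter_true, eval_star, eval_gen]; rfl
      rw [hl]
      by_cases h : j = k
      · subst h
        cases β
        · exact h2 _ hb (fun k h => ⟨⟨_, toeplitz_relation θ h⟩, ⟨_, w_mul_star_w θ h⟩⟩) m hm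
        · exact h2 _ hb' (fun k h => ⟨⟨_, toeplitz_relation_star θ h⟩,
            ⟨_, star_w_mul_star_w θ h⟩⟩) m hm
      · cases β
        · exact h1 _ (w_mem_awayFrom θ h) m hm
        · exact h1 _ (star_w_mem_awayFrom θ h) m hm
    · intro f g hf hg m hm
      rw [map_mul, mul_assoc]
      exact hf _ (hg m hm)
    · intro f g hf hg m hm
      rw [map_add, add_mul]
      exact add_mem (hf m hm) (hg m hm)
  have h3 : (1 : TwistedToeplitz θ) ∈ M := by
    rw [← mul_one (1 : TwistedToeplitz θ)]
    exact Submodule.mul_mem_mul (one_mem (awayFrom θ j)) (one_mem C)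
  simpa using key 1 h3

/-- For x = v u with v commuting with p_j and u commuting with b, one has p_j x b = v (p_j b) u.
Sums of such products include all *-polynomials, which are dense, and the ideal is closed. -/
theorem defect_mul_mul_mem {j : Fin (N + 1)} {b : TwistedToeplitz θ} (hb : Commute b (w θ j))
    (hb' : Commute b (star (w θ j))) (x : TwistedToeplitz θ) :
    defect θ j * x * b ∈ closedIdeal (defect θ j * b) := by
  refine UniversalCStar.induction_on (P := fun x => defect θ j * x * b ∈
    closedIdeal (defect θ j * b)) x (IsClosed.preimage (by fun_prop)
      (inferInstance : IsClosed (closedIdeal (defect θ j * b) : Set (TwistedToeplitz θ)))) fun f => ?_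
  have hf : UniversalCStar.ofFree _ f = eval (w θ) f :=
    DFunLike.congr_fun UniversalCStar.ofFreeHom_eq f
  rw [hf]
  have := eval_mem_awayFrom_mul θ hb hb' f
  generalize eval (w θ) f = y at this ⊢
  induction this using Submodule.mul_induction_on' with
  | mem_mul_mem v hv u hu =>
    have hv' := commute_defect_of_mem_awayFrom θ hv
    have hu' : b * u = u * b := (Subalgebra.mem_centralizer_iff ℂ).1 hu b rfl
    have h : defect θ j * (v * u) * b = v * (defect θ j * b) * u := by
      rw [← mul_assoc, hv'.eq, mul_assoc _ u, ← hu']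
      simp only [mul_assoc]
    rw [h]
    exact Ideal.mul_mem_right _ _ (Ideal.mul_mem_left _ _ (mem_closedIdeal _))
  | add x _ y _ hx hy =>
    rw [mul_add, add_mul]
    exact add_mem hx hy

/-- The intersection of the ideals `I_i` is generated by the product of the `1 - w_i w_i*`. -/
theorem listInf_idealI_le {l : List (Fin (N + 1))} (hl : l.Nodup) :
    listInf (idealI θ) l ≤ closedIdeal (l.map (defect θ)).prod := by
  induction l with
  | nil =>
    intro x _
    rw [← mul_one x]
    exact Ideal.mul_mem_left _ _ (mem_closedIdeal _)
  | cons j l ih =>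
    rw [List.nodup_cons] at hl
    -- As j is not in l, the product of the remaining defects commutes with w_j and w_j* and can
    -- serve as b.
    have hc : ∀ a, (∀ i, i ≠ j → Commute (defect θ i) a) →
        Commute (l.map (defect θ)).prod a := fun a ha => by
      refine Commute.symm (Commute.list_prod_right _ _ fun y hy => ?_)
      obtain ⟨i, hi, rfl⟩ := List.mem_map.1 hy
      exact (ha i (ne_of_mem_of_not_mem hi hl.1)).symm
    rw [List.map_cons, List.prod_cons]
    exact (inf_le_inf_left (idealI θ j) (ih hl.2)).trans (closedIdeal_inf_le
      (defect_mul_mul_mem θ (hc _ fun i h => commute_defect_w θ h)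
        (hc _ fun i h => commute_defect_star_w θ h)))

end QuantumSphere

/-! ### The cocycle condition for maps induced from a common algebra. -/

section Transition

/-- Computes a transition isomorphism without inverting anything: the two induced maps send the
classes of a and a' to the same element. -/
theorem transition_mk {A A' B C D : Type*} [CStarAlgebra A] [CStarAlgebra A'] [CStarAlgebra B]
    [CStarAlgebra C] [CStarAlgebra D] (f : A →⋆ₐ[ℂ] B) (g : A →⋆ₐ[ℂ] C) (f' : A' →⋆ₐ[ℂ] B)
    (g' : A' →⋆ₐ[ℂ] D) (hf : Function.Surjective f) (hf' : Function.Surjective f')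
    (h : imageIdeal f hf (RingHom.ker g) = imageIdeal f' hf' (RingHom.ker g')) {a : A} {a' : A'}
    (haa' : f' a' = f a) :
    transition f g f' g' hf hf' h (Ideal.Quotient.mk _ a') = Ideal.Quotient.mk _ a := by
  rw [transition, RingEquiv.trans_apply, RingEquiv.symm_apply_eq]
  exact congrArg (Ideal.Quotient.mk (imageIdeal f hf (RingHom.ker g))) haa'

/-- The cocycle identity for the transition isomorphisms of algebras that are covered by a common
set `X` over which the homomorphisms agree. -/
theorem transition_cocycle {X A₁ A₂ A₃ P Q R : Type*} [CStarAlgebra A₁] [CStarAlgebra A₂]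
    [CStarAlgebra A₃] [CStarAlgebra P] [CStarAlgebra Q] [CStarAlgebra R]
    {a : X → A₁} {b : X → A₂} {c : X → A₃}
    (fp : A₁ →⋆ₐ[ℂ] P) (fq : A₁ →⋆ₐ[ℂ] Q) (gp : A₂ →⋆ₐ[ℂ] P) (gr : A₂ →⋆ₐ[ℂ] R)
    (kq : A₃ →⋆ₐ[ℂ] Q) (kr : A₃ →⋆ₐ[ℂ] R) (hfp : Function.Surjective fp)
    (hfq : Function.Surjective fq) (hgp : Function.Surjective gp) (hgr : Function.Surjective gr)
    (hkq : Function.Surjective kq) (hkr : Function.Surjective kr) (hc : Function.Surjective c)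
    (hp : ∀ x, gp (b x) = fp (a x)) (hq : ∀ x, kq (c x) = fq (a x))
    (hr : ∀ x, kr (c x) = gr (b x))
    (h₁ : imageIdeal fp hfp (RingHom.ker fq) = imageIdeal gp hgp (RingHom.ker gr))
    (h₂ : imageIdeal fq hfq (RingHom.ker fp) = imageIdeal kq hkq (RingHom.ker kr))
    (h₃ : imageIdeal gr hgr (RingHom.ker gp) = imageIdeal kr hkr (RingHom.ker kq))
    (x : A₃ ⧸ (RingHom.ker kq ⊔ RingHom.ker kr)) :
    quotientSwap _ _ (transition fq fp kq kr hfq hkq h₂ x)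
      = transition fp fq gp gr hfp hgp h₁ (quotientSwap _ _
          (transition gr gp kr kq hgr hkr h₃ (quotientSwap _ _ x))) := by
  obtain ⟨x, rfl⟩ := Ideal.Quotient.mk_surjective x
  -- Once the class is represented by c x, the transitions only exchange the classes of c x, b x and
  -- a x.
  obtain ⟨x, rfl⟩ := hc x
  simp only [quotientSwap, Ideal.quotEquivOfEq_mk, transition_mk fq fp kq kr hfq hkq h₂ (hq x),
    transition_mk gr gp kr kq hgr hkr h₃ (hr x), transition_mk fp fq gp gr hfp hgp h₁ (hp x)]

/-- The cocycle condition for homomorphisms `π^i_j` which are induced by homomorphisms from a common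
algebra. -/
theorem cocycleCondition_of_lift {J T : Type*} {A : J → Type*} {A₂ : Sym2 J → Type*}
    [CStarAlgebra T] [∀ i, CStarAlgebra (A i)] [∀ p, CStarAlgebra (A₂ p)]
    (π : ∀ (p : Sym2 J) (i : J), i ∈ p → (A i →⋆ₐ[ℂ] A₂ p)) (σ : ∀ i, T →⋆ₐ[ℂ] A i)
    (τ : ∀ p, T →⋆ₐ[ℂ] A₂ p) (hσ : ∀ i, Function.Surjective (σ i))
    (hτ : ∀ p, Function.Surjective (τ p)) (hπ : ∀ p i hi x, π p i hi (σ i x) = τ p x)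
    (H : ∀ (i j k : J), i ≠ k → ∀ (p q r : Sym2 J), i ∈ p → j ∈ p → i ∈ q → k ∈ q → j ∈ r →
      k ∈ r → ∀ y, τ q y = 0 → ∃ y', τ r y' = 0 ∧ τ p y' = τ p y) :
    CocycleCondition π := by
  have surj : ∀ p i hi, Function.Surjective (π p i hi) := fun p i hi x => by
    obtain ⟨y, rfl⟩ := hτ p x
    exact ⟨σ i y, hπ p i hi y⟩
  -- One inclusion suffices: the other follows by exchanging i with j and q with r.
  have key : ∀ (i j k : J), i ≠ k → ∀ (p q r : Sym2 J)
      (hip : i ∈ p) (hjp : j ∈ p) (hiq : i ∈ q) (_ : k ∈ q) (hjr : j ∈ r) (_ : k ∈ r),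
      imageIdeal (π p i hip) (surj p i hip) (RingHom.ker (π q i hiq))
        ≤ imageIdeal (π p j hjp) (surj p j hjp) (RingHom.ker (π r j hjr)) := by
    rintro i j k hik p q r hip hjp hiq hkq hjr hkr _ ⟨b, hb, rfl⟩
    obtain ⟨y, rfl⟩ := hσ i b
    obtain ⟨y', h1, h2⟩ := H i j k hik p q r hip hjp hiq hkq hjr hkr y
      ((hπ q i hiq y).symm.trans hb)
    exact ⟨σ j y', (hπ r j hjr y').trans h1,
      (hπ p j hjp y').trans (h2.trans (hπ p i hip y).symm)⟩
  have comp : ∀ p i j (hi : i ∈ p) (hj : j ∈ p) x, π p j hj (σ j x) = π p i hi (σ i x) :=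
    fun p i j hi hj x => (hπ p j hj x).trans (hπ p i hi x).symm
  exact
    { surjective := surj
      image_ker := fun i j k _ hik hjk p q r hip hjp hiq hkq hjr hkr =>
        le_antisymm (key i j k hik p q r hip hjp hiq hkq hjr hkr)
          (key j i k hjk p r q hjp hip hjr hkr hiq hkq)
      transition_eq := fun i j k _ _ _ p q r hip hjp hiq hkq hjr hkr =>
        transition_cocycle _ _ _ _ _ _ _ _ _ _ _ _ (hσ k) (comp p i j hip hjp)
          (comp q i k hiq hkq) (comp r j k hjr hkr) _ _ _ }

end Transition

/-! ### Both sphere algebras as the quotient T / ⋂ I_i. -/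

namespace QuantumSphere

open FreeStarAlgebra CStarQuotient

variable {N : ℕ} (θ : Matrix (Fin (N + 1)) (Fin (N + 1)) ℝ)

/-- The ideal `⋂ I_i` of the twisted Toeplitz algebra. -/
abbrev coreIdeal : Ideal (TwistedToeplitz θ) := listInf (idealI θ) (List.finRange (N + 1))

theorem mem_coreIdeal {a : TwistedToeplitz θ} : a ∈ coreIdeal θ ↔ ∀ i, a ∈ idealI θ i := by
  simp [mem_listInf]

theorem prod_defect_mem (l : List (Fin (N + 1))) {i : Fin (N + 1)} (hi : i ∈ l) :
    (l.map (defect θ)).prod ∈ idealI θ i := by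
  induction l with
  | nil => simp at hi
  | cons j l ih =>
    rw [List.map_cons, List.prod_cons]
    rcases List.mem_cons.1 hi with rfl | hi
    · exact Ideal.mul_mem_right _ _ (mem_closedIdeal _)
    · exact Ideal.mul_mem_left _ _ (ih hi)

theorem prod_defect_mem_coreIdeal :
    ((List.finRange (N + 1)).map (defect θ)).prod ∈ coreIdeal θ :=
  (mem_coreIdeal θ).2 fun _ => prod_defect_mem θ _ (List.mem_finRange _)

theorem coreIdeal_le :
    coreIdeal θ ≤ closedIdeal ((List.finRange (N + 1)).map (defect θ)).prod :=
  listInf_idealI_le θ (List.nodup_finRange _)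

/-- The diagonal homomorphism from the twisted Toeplitz algebra to the algebra of the quantum
sphere. -/
def toSphere : TwistedToeplitz θ →⋆ₐ[ℂ] heegaardSphere θ where
  toFun a := ⟨fun k => σ θ k a,
    fun j k _ => (π_σ θ s(j, k) j _ _).trans (π_σ θ s(j, k) k _ _).symm⟩
  map_one' := Subtype.ext (funext fun i => map_one (σ θ i))
  map_mul' a b := Subtype.ext (funext fun i => map_mul (σ θ i) a b)
  map_zero' := Subtype.ext (funext fun i => map_zero (σ θ i))
  map_add' a b := Subtype.ext (funext fun i => map_add (σ θ i) a b)
  commutes' c := Subtype.ext (funext fun i => AlgHomClass.commutes (σ θ i) c)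
  map_star' a := Subtype.ext (funext fun i => map_star (σ θ i) a)

@[simp]
theorem toSphere_w (i : Fin (N + 1)) : toSphere θ (w θ i) = sphereGen θ i := rfl

theorem toSphere_eq_zero {a : TwistedToeplitz θ} : toSphere θ a = 0 ↔ a ∈ coreIdeal θ := by
  rw [mem_coreIdeal, Subtype.ext_iff, funext_iff]
  exact forall_congr' fun i => Ideal.Quotient.eq_zero_iff_mem

/-- Lift each component b_i to t_i in T. Compatibility says t_i - t_j ∈ I_i + I_j, which is the
hypothesis of the Chinese remainder theorem. -/
theorem toSphere_surjective : Function.Surjective (toSphere θ) := by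
  intro b
  choose t ht using fun i => CStarQuotient.mk_surjective (idealI θ i) (b.1 i)
  obtain ⟨x, hx⟩ := exists_forall_sub_mem (idealI θ) t (List.finRange (N + 1))
    ((List.nodup_finRange (N + 1)).imp fun {i j} h => by
      have hb := b.2 i j h
      rw [← ht, ← ht, π_σ, π_σ] at hb
      rw [sup_comm]
      exact (CStarQuotient.mk_eq_mk (I := pairIdeal θ s(i, j))).1 hb)
  refine ⟨x, Subtype.ext (funext fun i => ?_)⟩
  rw [← ht i]
  exact CStarQuotient.mk_eq_mk.2 (hx i (List.mem_finRange i))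

theorem sphere_relation {j k : Fin (N + 1)} (h : j ≠ k) :
    s θ j * s θ k = phase (θ j k) • (s θ k * s θ j) := by
  have := UniversalCStar.eval_of_eq_zero (R := sphereRelations θ) (Or.inl ⟨j, k, h, Or.inl rfl⟩)
  simpa [sub_eq_zero] using this

theorem sphere_relation_star {j k : Fin (N + 1)} (h : j ≠ k) :
    s θ j * star (s θ k) = phase (-θ j k) • (star (s θ k) * s θ j) := by
  have := UniversalCStar.eval_of_eq_zero (R := sphereRelations θ) (Or.inl ⟨j, k, h, Or.inr rfl⟩)
  simpa [sub_eq_zero] using this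

theorem eval_prod_ofFn {B : Type*} [CStarAlgebra B] (b : Fin (N + 1) → B) :
    eval b (List.ofFn fun i : Fin (N + 1) => 1 - gen i * star (gen i)).prod
      = ((List.finRange (N + 1)).map fun i => 1 - b i * star (b i)).prod := by
  rw [map_list_prod, List.ofFn_eq_map, List.map_map]
  congr 2
  funext i
  simp

theorem sphere_equation :
    ((List.finRange (N + 1)).map fun i => 1 - s θ i * star (s θ i)).prod = 0 := by
  have := UniversalCStar.eval_of_eq_zero (R := sphereRelations θ) (Or.inr rfl)
  rwa [eval_prod_ofFn] at this

/-- The homomorphism `s_i ↦ [w_i]` from `A_θ(N+1)` to `T / ⋂ I_i`. -/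
def sphereToQuotient (hθ : ∀ i j, θ i j = -θ j i) :
    UniversalSphere θ →⋆ₐ[ℂ] TwistedToeplitz θ ⧸ coreIdeal θ :=
  UniversalCStar.lift (fun i => CStarQuotient.mk (coreIdeal θ) (w θ i))
    (fun i => by rw [← map_star, ← map_mul, UniversalCStar.star_of_mul_of, map_one])
    (by
      rintro r (⟨i, j, h, rfl | rfl⟩ | rfl)
      · rw [map_sub, map_smul, map_mul, map_mul, eval_gen, eval_gen, ← map_mul, ← map_mul,
          ← map_smul, ← map_sub, sub_eq_zero.2 (toeplitz_relation θ h), map_zero]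
      -- The relation in T carries the phase of θ_ji, the sphere relation that of -θ_ij;
      -- antisymmetry identifies them.
      · rw [map_sub, map_smul, map_mul, map_mul, eval_star, eval_gen, eval_gen, ← map_star,
          ← map_mul, ← map_mul, ← map_smul, ← map_sub, w_mul_star_w θ h, hθ j i, sub_self,
          map_zero]
      · rw [eval_prod_ofFn]
        have h : (fun i => 1 - CStarQuotient.mk (coreIdeal θ) (w θ i) *
            star (CStarQuotient.mk (coreIdeal θ) (w θ i)))
            = CStarQuotient.mk (coreIdeal θ) ∘ defect θ := by
          funext i
          rw [Function.comp_apply, defect, map_sub, map_one, map_mul, map_star]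
        rw [h, ← List.map_map, ← map_list_prod]
        exact Ideal.Quotient.eq_zero_iff_mem.2 (prod_defect_mem_coreIdeal θ))

/-- The homomorphism `w_i ↦ s_i` from the twisted Toeplitz algebra to `A_θ(N+1)`. -/
def toeplitzToSphere (hθ : ∀ i j, θ i j = -θ j i) : TwistedToeplitz θ →⋆ₐ[ℂ] UniversalSphere θ :=
  UniversalCStar.lift (s θ) (fun i => UniversalCStar.star_of_mul_of i)
    (by
      rintro r ⟨j, k, h, rfl | rfl⟩
      · rw [map_sub, map_smul, map_mul, map_mul, eval_gen, eval_gen,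
          sub_eq_zero.2 (sphere_relation θ h)]
      · rw [map_sub, map_smul, map_mul, map_mul, eval_star, eval_gen, eval_gen,
          sphere_relation_star θ h.symm, smul_smul, ← hθ k j, phase_mul_phase_neg, one_smul,
          sub_self])

theorem sphereToQuotient_s (hθ : ∀ i j, θ i j = -θ j i) (i : Fin (N + 1)) :
    sphereToQuotient θ hθ (s θ i) = CStarQuotient.mk (coreIdeal θ) (w θ i) := by
  rw [sphereToQuotient, UniversalCStar.lift_of]

theorem toeplitzToSphere_w (hθ : ∀ i j, θ i j = -θ j i) (i : Fin (N + 1)) :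
    toeplitzToSphere θ hθ (w θ i) = s θ i := by
  rw [toeplitzToSphere, UniversalCStar.lift_of]

/-- The sphere equation kills ∏ p_i, hence the closed ideal it generates, and by `coreIdeal_le` that
ideal contains ⋂ I_i. -/
theorem toeplitzToSphere_eq_zero (hθ : ∀ i j, θ i j = -θ j i) {a : TwistedToeplitz θ}
    (ha : a ∈ coreIdeal θ) : toeplitzToSphere θ hθ a = 0 := by
  refine closedIdeal_le (I := RingHom.ker (toeplitzToSphere θ hθ)) ?_ ?_ (coreIdeal_le θ ha)
  · exact isClosed_singleton.preimage (continuous_starAlgHom (toeplitzToSphere θ hθ))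
  · rw [RingHom.mem_ker, map_list_prod, List.map_map, ← sphere_equation θ]
    congr 2
    funext i
    rw [Function.comp_apply, defect, map_sub, map_one, map_mul, map_star, toeplitzToSphere_w]

/-- The isomorphism `A_θ(N+1) ≅ T / ⋂ I_i`. -/
def sphereEquivQuotient (hθ : ∀ i j, θ i j = -θ j i) :
    UniversalSphere θ ≃⋆ₐ[ℂ] TwistedToeplitz θ ⧸ coreIdeal θ :=
  let g : TwistedToeplitz θ ⧸ coreIdeal θ →⋆ₐ[ℂ] UniversalSphere θ :=
    CStarQuotient.lift (toeplitzToSphere θ hθ) fun _ ha => toeplitzToSphere_eq_zero θ hθ ha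
  StarAlgEquiv.ofStarAlgHom (sphereToQuotient θ hθ) g
    (UniversalCStar.hom_ext fun i => by
      rw [StarAlgHom.comp_apply, sphereToQuotient_s, CStarQuotient.lift_mk, toeplitzToSphere_w]
      rfl)
    (by
      have h : ((sphereToQuotient θ hθ).comp g).comp (CStarQuotient.mk (coreIdeal θ))
          = CStarQuotient.mk (coreIdeal θ) := UniversalCStar.hom_ext fun i => by
        rw [StarAlgHom.comp_apply, StarAlgHom.comp_apply, CStarQuotient.lift_mk,
          toeplitzToSphere_w, sphereToQuotient_s]
      ext x
      obtain ⟨a, rfl⟩ := CStarQuotient.mk_surjective _ x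
      exact DFunLike.congr_fun h a)

theorem sphereEquivQuotient_s (hθ : ∀ i j, θ i j = -θ j i) (i : Fin (N + 1)) :
    sphereEquivQuotient θ hθ (s θ i) = CStarQuotient.mk (coreIdeal θ) (w θ i) :=
  sphereToQuotient_s θ hθ i

/-- The isomorphism `T / ⋂ I_i ≅ C(S^{2N+1}_{H,θ})`. -/
def quotientEquivSphere : TwistedToeplitz θ ⧸ coreIdeal θ ≃⋆ₐ[ℂ] heegaardSphere θ :=
  let g : TwistedToeplitz θ ⧸ coreIdeal θ →⋆ₐ[ℂ] heegaardSphere θ :=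
    CStarQuotient.lift (toSphere θ) fun _ ha => (toSphere_eq_zero θ).2 ha
  StarAlgEquiv.ofBijective g
    ⟨(injective_iff_map_eq_zero g).2 fun x => by
      obtain ⟨a, rfl⟩ := CStarQuotient.mk_surjective _ x
      intro h
      exact Ideal.Quotient.eq_zero_iff_mem.2 ((toSphere_eq_zero θ).1 h),
    fun b => by
      obtain ⟨a, rfl⟩ := toSphere_surjective θ b
      exact ⟨CStarQuotient.mk _ a, rfl⟩⟩

/-- The isomorphism `φ_θ : A_θ(N+1) → C(S^{2N+1}_{H,θ})`. -/
def sphereEquiv (hθ : ∀ i j, θ i j = -θ j i) : UniversalSphere θ ≃⋆ₐ[ℂ] heegaardSphere θ :=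
  (sphereEquivQuotient θ hθ).trans (quotientEquivSphere θ)

theorem sphereEquiv_s (hθ : ∀ i j, θ i j = -θ j i) (i : Fin (N + 1)) :
    sphereEquiv θ hθ (s θ i) = sphereGen θ i := by
  rw [sphereEquiv, StarAlgEquiv.trans_apply, sphereEquivQuotient_s]
  rfl

/-! ### The gauge action: continuity and transport to A_θ(N+1). -/

theorem α_toSphere (z : Circle) (a : TwistedToeplitz θ) :
    α θ z (toSphere θ a) = toSphere θ (gaugeHom θ (fun _ => z) a) := rfl

theorem continuous_gaugeHom (a : TwistedToeplitz θ) :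
    Continuous fun z : Circle => gaugeHom θ (fun _ => z) a := by
  refine UniversalCStar.induction_on (P := fun a => Continuous fun z : Circle =>
    gaugeHom θ (fun _ => z) a) a ?_ fun f => ?_
  -- *-homomorphisms are contractive, so approximating a approximates its orbit map uniformly in z,
  -- and uniform limits of continuous maps are continuous.
  · refine isClosed_of_closure_subset fun a ha => ?_
    rw [Metric.mem_closure_iff] at ha
    refine continuous_of_uniform_approx_of_continuous fun u hu => ?_
    obtain ⟨ε, hε, h⟩ := Metric.mem_uniformity_dist.1 hu
    obtain ⟨b, hb, hab⟩ := ha ε hε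
    refine ⟨_, hb, fun z => h ?_⟩
    rw [dist_eq_norm, ← map_sub]
    exact (NonUnitalStarAlgHom.norm_apply_le _ _).trans_lt (by rwa [← dist_eq_norm])
  · have hf : UniversalCStar.ofFree _ f = eval (w θ) f :=
      DFunLike.congr_fun UniversalCStar.ofFreeHom_eq f
    rw [hf]
    refine FreeStarAlgebra.induction (P := fun f => Continuous fun z : Circle =>
      gaugeHom θ (fun _ => z) (eval (w θ) f)) ?_ ?_ ?_ ?_ f
    · intro c
      simp only [AlgHomClass.commutes]
      exact continuous_const
    · have hw : ∀ k, Continuous fun z : Circle => gaugeHom θ (fun _ => z) (w θ k) := fun k => by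
        simp only [gaugeHom_w]
        exact Continuous.smul continuous_subtype_val continuous_const
      rintro ⟨k, β⟩
      cases β
      · exact (eval_gen (w θ) k).symm ▸ hw k
      · simp only [letter_true, map_star, eval_gen]
        exact (hw k).star
    · intro f g hf hg
      simp only [map_mul]
      exact hf.mul hg
    · intro f g hf hg
      simp only [map_add]
      exact hf.add hg

theorem continuous_α (b : heegaardSphere θ) : Continuous fun z => α θ z b := by
  obtain ⟨a, rfl⟩ := toSphere_surjective θ b
  simp only [α_toSphere]
  exact (continuous_starAlgHom (toSphere θ)).comp (continuous_gaugeHom θ a)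

theorem α_sphereGen (z : Circle) (i : Fin (N + 1)) :
    α θ z (sphereGen θ i) = (z : ℂ) • sphereGen θ i := by
  rw [← toSphere_w, α_toSphere, gaugeHom_w, map_smul]

/-- The gauge action on `A_θ(N+1)`. -/
def gaugeUniversal (hθ : ∀ i j, θ i j = -θ j i) :
    Circle →* (UniversalSphere θ ≃⋆ₐ[ℂ] UniversalSphere θ) where
  toFun z := ((sphereEquiv θ hθ).trans (α θ z)).trans (sphereEquiv θ hθ).symm
  map_one' := by
    ext a
    simp
  map_mul' z z' := by
    ext a
    simp

theorem sphereEquiv_gaugeUniversal (hθ : ∀ i j, θ i j = -θ j i) (z : Circle)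
    (a : UniversalSphere θ) :
    sphereEquiv θ hθ (gaugeUniversal θ hθ z a) = α θ z (sphereEquiv θ hθ a) :=
  (sphereEquiv θ hθ).apply_symm_apply _

/-- Write an element of I_i + I_k as a + b. Then b lies in I_j + I_k, and it has the same class as a
+ b modulo I_i + I_j; this exchange gives the equality of images of kernels. -/
theorem cocycleCondition : CocycleCondition (π θ) :=
  cocycleCondition_of_lift (π θ) (σ θ) (fun p => CStarQuotient.mk (pairIdeal θ p))
    (fun i => CStarQuotient.mk_surjective (idealI θ i))
    (fun p => CStarQuotient.mk_surjective (pairIdeal θ p)) (π_σ θ)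
    (fun i j k hik p q r hip _ hiq hkq _ hkr y hy => by
      have hy' : y ∈ pairIdeal θ q := Ideal.Quotient.eq_zero_iff_mem.1 hy
      rw [(Sym2.mem_and_mem_iff hik).1 ⟨hiq, hkq⟩] at hy'
      obtain ⟨a, ha, b, hb, rfl⟩ := Submodule.mem_sup.1 hy'
      refine ⟨b, Ideal.Quotient.eq_zero_iff_mem.2 (idealI_le_pairIdeal θ hkr hb),
        CStarQuotient.mk_eq_mk.2 ?_⟩
      rw [sub_add_cancel_right]
      exact neg_mem (idealI_le_pairIdeal θ hip ha))

end QuantumSphere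

end

theorem mainTheorem2 (N : ℕ) (hN : 1 ≤ N) (θ : Matrix (Fin (N + 1)) (Fin (N + 1)) ℝ)
    (hθ : ∀ i j, θ i j = -θ j i) :
    (∃ β : Circle →* (QuantumSphere.UniversalSphere θ ≃⋆ₐ[ℂ] QuantumSphere.UniversalSphere θ),
      (∀ a, Continuous fun z => β z a) ∧
      (∀ (z : Circle) (i : Fin (N + 1)),
        β z (QuantumSphere.s θ i) = (z : ℂ) • QuantumSphere.s θ i) ∧
      ∃ φ : QuantumSphere.UniversalSphere θ ≃⋆ₐ[ℂ] QuantumSphere.heegaardSphere θ,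
        (∀ (z : Circle) (a : QuantumSphere.UniversalSphere θ),
          φ (β z a) = QuantumSphere.α θ z (φ a)) ∧
        ∀ i, φ (QuantumSphere.s θ i) = QuantumSphere.sphereGen θ i) ∧
    CocycleCondition (QuantumSphere.π θ) := by
  refine ⟨⟨QuantumSphere.gaugeUniversal θ hθ, fun a => ?_, fun z i => ?_,
    QuantumSphere.sphereEquiv θ hθ, QuantumSphere.sphereEquiv_gaugeUniversal θ hθ,
    QuantumSphere.sphereEquiv_s θ hθ⟩, QuantumSphere.cocycleCondition θ⟩
  · exact (continuous_starAlgHom (QuantumSphere.sphereEquiv θ hθ).symm.toStarAlgHom).comp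
      (QuantumSphere.continuous_α θ _)
  -- The formula on generators is checked after applying the isomorphism, where the action becomes
  -- α.
  · refine EquivLike.injective (QuantumSphere.sphereEquiv θ hθ) ?_
    rw [QuantumSphere.sphereEquiv_gaugeUniversal, QuantumSphere.sphereEquiv_s, map_smul,
      QuantumSphere.sphereEquiv_s, QuantumSphere.α_sphereGen]
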